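/- Let $G=*_{n\ge 1}\mathbb{Z}^n$ be the free product of the groups $\mathbb{Z}^n$, $n\ge1$, and let $a_{1,n},\dots,a_{n,n}$ denote the standard generators of $\mathbb{Z}^n$. Let $f:\mathbb{N}\to\mathbb{N}$ be strictly increasing on $\{1,2,\dots\}$ with $f(1)=1$, and suppose that $f^{-1}(N)=o\left(\frac{N}{\ln N}\right)$ as $N\to\infty$, where $f^{-1}(N)$ denotes the largest $n\ge1$ with $f(n)\le N$. Let $l$ be the length on $G$ in which each $a_{i,n}$ has length $f(n)$: an element $v=(v_1,\dots,v_n)\in\mathbb{Z}^n$ has $l(v)=f(n)\sum_i|v_i|$, and the length of a reduced word is the sum of the lengths of its syllables. Terminology. A length function on a group $\Gamma$ is a function $\ell:\Gamma\to\mathbb{R}_{\ge0}$ with $\ell(e)=0$, $\ell(g^{-1})=\ell(g)$ and $\ell(gh)\le\ell(g)+\ell(h)$ for all $g,h$. A function $d:\mathbb{N}\to\mathbb{R}$ is a decay function for $(\Gamma,\ell)$ if $\|x\|\le d(D)\|x\|_2$ for all $D\in\mathbb{N}$ and all $x\in\mathbb{C}[\Gamma]$ supported on $\{g:\ell(g)\le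 D\}$, where $\|x\|$ is the operator norm of $x$ acting on $\ell^2(\Gamma)$ by the left regular representation and $\|x\|_2=\left(\sum_g|x(g)|^2\right)^{1/2}$. The group $\Gamma$ has property SD with respect to a length function $\ell$ if $(\Gamma,\ell)$ has a decay function $d:\mathbb{N}\to\mathbb{R}_{\ge0}$ with $\lim_{n\to\infty} d(n)^{1/n}=1$; it has property RD with respect to $\ell$ if $(\Gamma,\ell)$ has a polynomial decay function. Then $l$ is a length function and $G$ has SD with respect to $l$, but $G$ has RD with respect to no length function. Moreover, every amenable subgroup of $G$ has polynomial growth; that is, it is finitely generated and, for each of its finite generating sets, the number of elements of word length at most $n$ is bounded by a polynomial in $n$. -/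

import Mathlib

open Filter Topology Asymptotics
open scoped ENNReal

noncomputable section

namespace GroupDecay

/-! ### Length functions and decay -/

/-- A length function on a group: it vanishes at the identity, is symmetric and subadditive, and
takes values in the nonnegative reals. -/
structure IsLengthFunction {G : Type*} [Group G] (l : G → ℝ) : Prop where
  nonneg : ∀ g, 0 ≤ l g
  map_one : l 1 = 0
  map_inv : ∀ g, l g⁻¹ = l g
  map_mul_le : ∀ g h, l (g * h) ≤ l g + l h

/-- The Hilbert space `ℓ²(G)`. -/
abbrev EllTwo (G : Type*) : Type _ := lp (fun _ : G => ℂ) 2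

lemma memℓp_leftTranslate {G : Type*} [Group G] (g : G) (ξ : EllTwo G) :
    Memℓp (fun h : G => ξ (g⁻¹ * h)) 2 := by
  have hp : 0 < (2 : ℝ≥0∞).toReal := by norm_num
  have h := (memℓp_gen_iff hp).1 (lp.memℓp ξ)
  exact (memℓp_gen_iff hp).2 ((Equiv.mulLeft g⁻¹).summable_iff.2 h)

/-- Left translation by `g` on `ℓ²(G)`: `(λ(g) ξ)(h) = ξ(g⁻¹ h)`. -/
def leftTranslate {G : Type*} [Group G] (g : G) : EllTwo G →ₗᵢ[ℂ] EllTwo G where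
  toFun ξ := ⟨fun h => ξ (g⁻¹ * h), memℓp_leftTranslate g ξ⟩
  map_add' _ _ := rfl
  map_smul' _ _ := rfl
  norm_map' ξ := by
    have hp : 0 < (2 : ℝ≥0∞).toReal := by norm_num
    rw [lp.norm_eq_tsum_rpow hp, lp.norm_eq_tsum_rpow hp]
    congr 1
    exact (Equiv.mulLeft g⁻¹).tsum_eq fun h : G => ‖ξ h‖ ^ (2 : ℝ≥0∞).toReal

lemma leftTranslate_apply {G : Type*} [Group G] (g : G) (ξ : EllTwo G) (h : G) :
    leftTranslate g ξ h = ξ (g⁻¹ * h) := rfl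

/-- The left regular representation `λ` of `G` on `ℓ²(G)`. -/
def leftRegular (G : Type*) [Group G] : G →* (EllTwo G →L[ℂ] EllTwo G) where
  toFun g := (leftTranslate g).toContinuousLinearMap
  map_one' := by
    ext ξ h
    simp [leftTranslate_apply]
  map_mul' a b := by
    ext ξ h
    simp [leftTranslate_apply, mul_assoc]

/-- The operator norm of an element of `ℂ[G]`, acting on `ℓ²(G)` by the left regular
representation (extended linearly from `G` to `ℂ[G]`). -/
def regularNorm {G : Type*} [Group G] (x : MonoidAlgebra ℂ G) : ℝ :=
  ‖MonoidAlgebra.lift ℂ (EllTwo G →L[ℂ] EllTwo G) G (leftRegular G) x‖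

/-- The `2`-norm `(∑ |x(g)|²)^{1/2}` of an element of `ℂ[G]`. -/
def twoNorm {G : Type*} [Group G] (x : MonoidAlgebra ℂ G) : ℝ :=
  Real.sqrt (∑ g ∈ x.coeff.support, ‖x.coeff g‖ ^ 2)

/-- `d` is a decay function for `(G, l)`: `‖x‖ ≤ d(n) ‖x‖₂` for every `x ∈ ℂ[G]` supported on the
closed `l`-ball of radius `n` around the identity. -/
def IsDecayFunction {G : Type*} [Group G] (l : G → ℝ) (d : ℕ → ℝ) : Prop :=
  ∀ (n : ℕ) (x : MonoidAlgebra ℂ G), (∀ g ∈ x.coeff.support, l g ≤ n) →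
    regularNorm x ≤ d n * twoNorm x

/-- A function `d : ℕ → ℝ_{≥ 0}` is subexponential if `d(n)^{1/n} → 1`. -/
def IsSubexponential (d : ℕ → ℝ) : Prop :=
  (∀ n, 0 ≤ d n) ∧ Tendsto (fun n : ℕ => d n ^ (1 / (n : ℝ))) atTop (𝓝 1)

/-- `l` is a length function, and `G` has property SD (subexponential decay) with respect to it. -/
def HasSDWithRespectTo {G : Type*} [Group G] (l : G → ℝ) : Prop :=
  IsLengthFunction l ∧ ∃ d : ℕ → ℝ, IsSubexponential d ∧ IsDecayFunction l d

/-- `l` is a length function, and `G` has property RD (rapid decay) with respect to it: some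
polynomial is a decay function for `(G, l)`. -/
def HasRDWithRespectTo {G : Type*} [Group G] (l : G → ℝ) : Prop :=
  IsLengthFunction l ∧ ∃ P : Polynomial ℝ, IsDecayFunction l fun n => P.eval (n : ℝ)

/-- `G` has property RD: it has RD with respect to some length function. -/
def HasRD (G : Type*) [Group G] : Prop :=
  ∃ l : G → ℝ, HasRDWithRespectTo l

/-! ### Amenability and growth -/

/-- A (discrete) group is amenable if it carries a left-invariant finitely additive probability
measure, defined on all subsets. -/
def IsAmenable (H : Type*) [Group H] : Prop :=
  ∃ m : Set H → ℝ, (∀ A, 0 ≤ m A) ∧ m Set.univ = 1 ∧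
    (∀ A B, Disjoint A B → m (A ∪ B) = m A + m B) ∧
    ∀ (h : H) (A : Set H), m ((fun x => h * x) '' A) = m A

/-- The ball of radius `n` for the word length of a subset `S` of a group: the products of at most
`n` elements of `S ∪ S⁻¹`. -/
def wordBall {H : Type*} [Group H] (S : Set H) (n : ℕ) : Set H :=
  {g | ∃ w : List H, w.length ≤ n ∧ (∀ s ∈ w, s ∈ S ∨ s⁻¹ ∈ S) ∧ w.prod = g}

/-- A group has polynomial growth if it is finitely generated and, for every finite generating set,
the cardinality of the ball of radius `n` is bounded by a polynomial in `n`. -/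
def HasPolynomialGrowth (H : Type*) [Group H] : Prop :=
  Group.FG H ∧ ∀ S : Set H, S.Finite → Subgroup.closure S = ⊤ →
    ∃ C k : ℕ, ∀ n : ℕ, (wordBall S n).ncard ≤ C * (n + 1) ^ k

/-! ### The free product of the groups `ℤⁿ`, `n ≥ 1` -/

/-- The group `ℤⁿ`, written multiplicatively. -/
abbrev ZPow (n : ℕ+) : Type := Multiplicative (Fin (n : ℕ) → ℤ)

/-- The free product of the groups `ℤⁿ` over all `n ≥ 1`. -/
abbrev FreeProdZ : Type := Monoid.CoprodI ZPow

/-- The standard generator `a_{i,n}` of the free factor `ℤⁿ`. -/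
def stdGen (n : ℕ+) (i : Fin (n : ℕ)) : FreeProdZ :=
  Monoid.CoprodI.of (M := ZPow) (i := n) (Multiplicative.ofAdd (Pi.single i 1))

/-- The length of an element of `ℤⁿ` when each standard generator is given length `f n`:
`f(n) (|v₁| + ⋯ + |vₙ|)`. -/
def syllableLength (f : ℕ → ℕ) (s : Σ n : ℕ+, ZPow n) : ℕ :=
  f s.1 * ∑ i, (Multiplicative.toAdd s.2 i).natAbs

/-- The length function on the free product for which each standard generator of `ℤⁿ` has length
`f n`: the length of a reduced word is the sum of the lengths of its syllables. -/
def freeProdLength (f : ℕ → ℕ) (g : FreeProdZ) : ℝ :=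
  (((Monoid.CoprodI.Word.equiv g).toList.map (syllableLength f)).sum : ℕ)

lemma freeProdLength_stdGen (f : ℕ → ℕ) (n : ℕ+) (i : Fin (n : ℕ)) :
    freeProdLength f (stdGen n i) = f n := by
  have hne : (Multiplicative.ofAdd (Pi.single i 1) : ZPow n) ≠ 1 := by
    intro h
    have h' := congrFun (congrArg Multiplicative.toAdd h) i
    simp at h'
  have hidx : (Monoid.CoprodI.Word.empty : Monoid.CoprodI.Word ZPow).fstIdx ≠ some n := by
    intro h
    cases h
  have hw : Monoid.CoprodI.Word.equiv (stdGen n i) =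
      Monoid.CoprodI.Word.cons (M := ZPow) (i := n) (Multiplicative.ofAdd (Pi.single i 1))
        Monoid.CoprodI.Word.empty hidx hne := by
    apply Monoid.CoprodI.Word.equiv.symm.injective
    rw [Equiv.symm_apply_apply]
    refine Eq.trans ?_ (Monoid.CoprodI.Word.prod_cons n _ _ hne hidx).symm
    simp [stdGen]
  have hsum : ∑ j, ((Pi.single i 1 : Fin (n : ℕ) → ℤ) j).natAbs = 1 := by
    rw [Finset.sum_eq_single i]
    · simp
    · intro j _ hj
      simp [hj]
    · simp
  rw [freeProdLength, hw]
  simp [Monoid.CoprodI.Word.cons, Monoid.CoprodI.Word.empty, syllableLength, hsum]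

/-- The inverse `f⁻¹(N)` of a strictly increasing function `f` on `{1, 2, …}`: the largest `n ≥ 1`
with `f n ≤ N`. -/
def floorInverse (f : ℕ → ℕ) (N : ℕ) : ℕ :=
  sSup {n : ℕ | 1 ≤ n ∧ f n ≤ N}

end GroupDecay

end

open GroupDecay

/-! Subexponential decay is a Haagerup-type estimate. Factor `a = p c` and `g = p d`, where `p` is
the longest common prefix of the reduced words, so that `a⁻¹ g = c⁻¹ d`. If `a` has at most `N`
syllables, then at most `N + 1` prefixes `p` can occur for a given `a` or a given `g`. The word of
`c⁻¹ d` shows `c` up to its length and at most one merged syllable. If syllables come from sets of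
size at most `B`, this leaves `(N + 1) B` choices of `c`, and Cauchy–Schwarz bounds the norm
(`sum_sq_convolution_le`, `regularNorm_le_of_syllables`). In the ball of radius `N` there are at
most `N` syllables, and `ℤⁿ` contributes only if `f n ≤ N`, so `B = (2N + 1) ^ floorInverse f N`
works. The growth condition on `f` is what makes `log B = o(N)`.

RD fails because boxes of side `k` in `ℤⁿ` have small doubling: a decay function must satisfy `kⁿ ≤
2ⁿ d(Lk)²` for every `n`, which excludes every polynomial (`not_hasRD_of_injective_ZPow`).

For amenable subgroups, the maps `v ↦ ∑ vᵢ Nⁱ` on the factors show that the free product is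
residually free. An amenable subgroup has amenable, hence abelian, images in free groups, so it is
abelian (`IsAmenable.commute_freeProdZ`). After conjugating so that a nontrivial element has least
possible syllable length, an abelian subgroup either lies in one factor or is cyclic. It is thus
finitely generated (`fg_of_commute`), and finitely generated abelian groups have polynomial growth.
-/

namespace GroupDecay

open Monoid

/-! ### Reduced words in free products and their cancellation -/

section Words

variable {ι : Type*} {G : ι → Type*} [∀ i, Group (G i)]

/-- A list of syllables is reduced if no syllable is trivial and adjacent syllables come from
different factors. -/
def IsReducedList (L : List (Σ i, G i)) : Prop :=
  (∀ l ∈ L, l.2 ≠ 1) ∧ L.IsChain fun l l' => l.1 ≠ l'.1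

/-- The product in the free product of a list of syllables. -/
def listProd (L : List (Σ i, G i)) : CoprodI G :=
  (L.map fun l => CoprodI.of l.2).prod

/-- The formal inverse of a list of syllables. -/
def invList (L : List (Σ i, G i)) : List (Σ i, G i) :=
  (L.map fun l => ⟨l.1, l.2⁻¹⟩).reverse

lemma listProd_nil : listProd ([] : List (Σ i, G i)) = 1 := rfl

lemma listProd_cons (a : Σ i, G i) (L : List (Σ i, G i)) :
    listProd (a :: L) = CoprodI.of a.2 * listProd L := by
  simp [listProd]

lemma listProd_append (L L' : List (Σ i, G i)) :
    listProd (L ++ L') = listProd L * listProd L' := by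
  simp [listProd]

lemma invList_nil : invList ([] : List (Σ i, G i)) = [] := rfl

lemma invList_cons (a : Σ i, G i) (L : List (Σ i, G i)) :
    invList (a :: L) = invList L ++ [⟨a.1, a.2⁻¹⟩] := by
  simp [invList]

lemma length_invList (L : List (Σ i, G i)) : (invList L).length = L.length := by
  simp [invList]

lemma listProd_invList (L : List (Σ i, G i)) : listProd (invList L) = (listProd L)⁻¹ := by
  induction L with
  | nil => simp [invList_nil, listProd_nil]
  | cons a L ih => simp [invList_cons, listProd_append, listProd_cons, ih, listProd_nil]

lemma isReducedList_append {L L' : List (Σ i, G i)} :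
    IsReducedList (L ++ L') ↔ IsReducedList L ∧ IsReducedList L' ∧
      ∀ a ∈ L.getLast?, ∀ b ∈ L'.head?, a.1 ≠ b.1 := by
  simp only [IsReducedList, List.mem_append, List.isChain_append]
  grind

lemma isReducedList_cons {a : Σ i, G i} {L : List (Σ i, G i)} :
    IsReducedList (a :: L) ↔ a.2 ≠ 1 ∧ IsReducedList L ∧ ∀ b ∈ L.head?, a.1 ≠ b.1 := by
  simp only [IsReducedList, List.mem_cons, List.isChain_cons]
  grind

lemma isReducedList_singleton {a : Σ i, G i} (h : a.2 ≠ 1) : IsReducedList [a] := by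
  simp [IsReducedList, h]

lemma isReducedList_nil : IsReducedList ([] : List (Σ i, G i)) := by
  simp [IsReducedList]

lemma head?_invList (L : List (Σ i, G i)) :
    (invList L).head? = L.getLast?.map fun l => ⟨l.1, l.2⁻¹⟩ := by
  simp [invList]

lemma getLast?_invList (L : List (Σ i, G i)) :
    (invList L).getLast? = L.head?.map fun l => ⟨l.1, l.2⁻¹⟩ := by
  simp [invList]

lemma IsReducedList.invList {L : List (Σ i, G i)} (h : IsReducedList L) :
    IsReducedList (invList L) := by
  induction L with
  | nil => exact isReducedList_nil
  | cons a L ih =>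
    obtain ⟨h1, h2, h3⟩ := isReducedList_cons.1 h
    rw [invList_cons, isReducedList_append]
    refine ⟨ih h2, isReducedList_singleton (by simpa using h1), ?_⟩
    intro c hc b hb
    rw [getLast?_invList] at hc
    simp only [Option.mem_def, Option.map_eq_some_iff] at hc
    obtain ⟨d, hd, rfl⟩ := hc
    simp only [List.head?_cons, Option.mem_def, Option.some.injEq] at hb
    subst hb
    exact (h3 d hd).symm

variable [DecidableEq ι] [∀ i, DecidableEq (G i)]

/-- The reduced list of syllables of an element of a free product. -/
def syllables (g : CoprodI G) : List (Σ i, G i) :=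
  (CoprodI.Word.equiv g).toList

lemma isReducedList_syllables (g : CoprodI G) : IsReducedList (syllables g) :=
  ⟨(CoprodI.Word.equiv g).ne_one, (CoprodI.Word.equiv g).chain_ne⟩

lemma listProd_syllables (g : CoprodI G) : listProd (syllables g) = g :=
  CoprodI.Word.equiv.symm_apply_apply g

lemma syllables_listProd {L : List (Σ i, G i)} (h : IsReducedList L) :
    syllables (listProd L) = L := by
  have := CoprodI.Word.equiv.apply_symm_apply (⟨L, h.1, h.2⟩ : CoprodI.Word G)
  exact congrArg CoprodI.Word.toList this

lemma syllables_eq {g : CoprodI G} {L : List (Σ i, G i)} (h : IsReducedList L)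
    (hg : listProd L = g) : syllables g = L := by
  rw [← hg, syllables_listProd h]

lemma syllables_injective : Function.Injective (syllables : CoprodI G → List (Σ i, G i)) := by
  intro g h hgh
  rw [← listProd_syllables g, hgh, listProd_syllables]

lemma syllables_one : syllables (1 : CoprodI G) = [] :=
  syllables_eq isReducedList_nil listProd_nil

lemma syllables_eq_nil {g : CoprodI G} : syllables g = [] ↔ g = 1 := by
  rw [← syllables_one, syllables_injective.eq_iff]

lemma syllables_inv (g : CoprodI G) : syllables g⁻¹ = invList (syllables g) :=
  syllables_eq (isReducedList_syllables g).invList (by rw [listProd_invList, listProd_syllables])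

lemma syllables_of {i : ι} {m : G i} (h : m ≠ 1) :
    syllables (CoprodI.of m : CoprodI G) = [⟨i, m⟩] :=
  syllables_eq (isReducedList_singleton h) (by simp [listProd])

lemma syllables_mul {g h : CoprodI G}
    (H : ∀ a ∈ (syllables g).getLast?, ∀ b ∈ (syllables h).head?, a.1 ≠ b.1) :
    syllables (g * h) = syllables g ++ syllables h :=
  syllables_eq
    (isReducedList_append.2 ⟨isReducedList_syllables g, isReducedList_syllables h, H⟩)
    (by rw [listProd_append, listProd_syllables, listProd_syllables])

lemma exists_common_prefix {α : Type*} (L L' : List α) :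
    ∃ P C D, L = P ++ C ∧ L' = P ++ D ∧ ∀ c ∈ C.head?, ∀ d ∈ D.head?, c ≠ d := by
  classical
  induction L generalizing L' with
  | nil => exact ⟨[], [], L', rfl, rfl, by simp⟩
  | cons a L ih =>
    cases L' with
    | nil => exact ⟨[], a :: L, [], rfl, rfl, by simp⟩
    | cons b L' =>
      by_cases hab : a = b
      · obtain ⟨P, C, D, h1, h2, h3⟩ := ih L'
        exact ⟨a :: P, C, D, by simp [h1], by simp [h2, hab], h3⟩
      · exact ⟨[], a :: L, b :: L', rfl, rfl, by simpa using hab⟩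

/-- After removing the common prefix of two reduced words, the quotient `g⁻¹ h` is read off from the
remaining suffixes with at most one merging of syllables. -/
lemma exists_syllables_inv_mul (g h : CoprodI G) :
    ∃ P C D, syllables g = P ++ C ∧ syllables h = P ++ D ∧
      (syllables (g⁻¹ * h) = invList C ++ D ∨
        ∃ (i : ι) (s t : G i) (C' D' : List (Σ i, G i)), C = ⟨i, s⟩ :: C' ∧ D = ⟨i, t⟩ :: D' ∧
          syllables (g⁻¹ * h) = invList C' ++ ⟨i, s⁻¹ * t⟩ :: D') := by
  obtain ⟨P, C, D, hg, hh, hne⟩ := exists_common_prefix (syllables g) (syllables h)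
  refine ⟨P, C, D, hg, hh, ?_⟩
  have hC : IsReducedList C := by
    have := isReducedList_syllables g
    rw [hg, isReducedList_append] at this
    exact this.2.1
  have hD : IsReducedList D := by
    have := isReducedList_syllables h
    rw [hh, isReducedList_append] at this
    exact this.2.1
  have hprod : g⁻¹ * h = (listProd C)⁻¹ * listProd D := by
    rw [← listProd_syllables g, ← listProd_syllables h, hg, hh, listProd_append, listProd_append]
    group
  by_cases hidx : ∀ a ∈ C.head?, ∀ b ∈ D.head?, a.1 ≠ b.1
  · left
    refine syllables_eq (isReducedList_append.2 ⟨hC.invList, hD, ?_⟩) ?_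
    · intro a ha b hb
      rw [getLast?_invList] at ha
      simp only [Option.mem_def, Option.map_eq_some_iff] at ha
      obtain ⟨d, hd, rfl⟩ := ha
      exact hidx d hd b hb
    · rw [listProd_append, listProd_invList, hprod]
  · right
    push Not at hidx
    obtain ⟨⟨i, s⟩, ha, ⟨j, t⟩, hb, hij⟩ := hidx
    obtain rfl : i = j := hij
    obtain ⟨C', rfl⟩ : ∃ C', C = ⟨i, s⟩ :: C' := by
      cases C with
      | nil => simp at ha
      | cons c C' => exact ⟨C', by simpa using ha⟩
    obtain ⟨D', rfl⟩ : ∃ D', D = ⟨i, t⟩ :: D' := by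
      cases D with
      | nil => simp at hb
      | cons c D' => exact ⟨D', by simpa using hb⟩
    refine ⟨i, s, t, C', D', rfl, rfl, ?_⟩
    -- Maximality of the common prefix forces the two leading syllables to differ, so the merged
    -- syllable `s⁻¹ * t` is nontrivial and no further cancellation occurs.
    have hst : s ≠ t := by
      have := hne _ ha _ hb
      intro h
      exact this (by rw [h])
    obtain ⟨_, hC', hC''⟩ := isReducedList_cons.1 hC
    obtain ⟨_, hD', hD''⟩ := isReducedList_cons.1 hD
    refine syllables_eq (isReducedList_append.2 ⟨hC'.invList, isReducedList_cons.2 ⟨?_, hD', hD''⟩,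
      ?_⟩) ?_
    · simpa [inv_mul_eq_one] using hst
    · intro a ha b hb
      rw [getLast?_invList] at ha
      simp only [Option.mem_def, Option.map_eq_some_iff] at ha
      obtain ⟨d, hd, rfl⟩ := ha
      simp only [List.head?_cons, Option.mem_def, Option.some.injEq] at hb
      subst hb
      exact (hC'' d hd).symm
    · rw [hprod, listProd_append, listProd_invList, listProd_cons, listProd_cons, listProd_cons]
      simp [mul_assoc]

end Words

/-! ### An abstract convolution estimate -/

section Convolution

lemma lift_leftRegular_apply {G : Type*} [Group G] (x : MonoidAlgebra ℂ G) (ξ : EllTwo G) (g : G) :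
    (MonoidAlgebra.lift ℂ (EllTwo G →L[ℂ] EllTwo G) G (leftRegular G) x ξ : EllTwo G) g =
      ∑ a ∈ x.coeff.support, x.coeff a * ξ (a⁻¹ * g) := by
  rw [MonoidAlgebra.lift_apply, Finsupp.sum, sum_apply, lp.coeFn_sum,
    Finset.sum_apply]
  rfl

lemma sum_norm_sq_le_norm_sq {α : Type*} (ξ : EllTwo α) (F : Finset α) :
    ∑ g ∈ F, ‖ξ g‖ ^ 2 ≤ ‖ξ‖ ^ 2 := by
  have h := lp.sum_rpow_le_norm_rpow (p := 2) (by norm_num) ξ F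
  simpa using h

lemma norm_le_of_sum_norm_sq_le {α : Type*} {ξ : EllTwo α} {C : ℝ} (hC : 0 ≤ C)
    (h : ∀ F : Finset α, ∑ g ∈ F, ‖ξ g‖ ^ 2 ≤ C ^ 2) : ‖ξ‖ ≤ C :=
  lp.norm_le_of_forall_sum_le (p := 2) (by norm_num) hC (by simpa using h)

/-- Group the terms `a` by `p = κ a g`, which takes at most `K` values for each `g`. Cauchy–Schwarz
over `p`, and then inside each group, leaves `K ∑ X p * Y p g`. Summing `X` costs another `K`, since
each `a` meets at most `K` values of `p`. Summing `Y p` over `g` costs `M`, since `p`, `b = a⁻¹ g`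
and the factor `p⁻¹ a ∈ C b` recover both `a` and `g`. -/
lemma sum_sq_convolution_le {G : Type*} [Group G] [DecidableEq G] (S F : Finset G) (κ : G → G → G)
    (K M : ℕ) (C : G → Finset G) (u v : G → ℝ) (V : ℝ)
    (hK : ∀ a ∈ S, (F.image (κ a)).card ≤ K)
    (hK' : ∀ g ∈ F, (S.image fun a => κ a g).card ≤ K)
    (hC : ∀ b, (C b).card ≤ M)
    (hκC : ∀ a ∈ S, ∀ g ∈ F, (κ a g)⁻¹ * a ∈ C (a⁻¹ * g))
    (hV : ∀ T : Finset G, ∑ b ∈ T, v b ^ 2 ≤ V) :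
    ∑ g ∈ F, (∑ a ∈ S, u a * v (a⁻¹ * g)) ^ 2 ≤ K ^ 2 * M * (∑ a ∈ S, u a ^ 2) * V := by
  set P : Finset G := (S ×ˢ F).image fun q => κ q.1 q.2 with hP
  have hmem : ∀ a ∈ S, ∀ g ∈ F, κ a g ∈ P := fun a ha g hg =>
    Finset.mem_image.2 ⟨(a, g), Finset.mem_product.2 ⟨ha, hg⟩, rfl⟩
  set X : G → ℝ := fun p => ∑ a ∈ S with p ∈ F.image (κ a), u a ^ 2 with hX
  set Y : G → G → ℝ := fun p g => ∑ a ∈ S with κ a g = p, v (a⁻¹ * g) ^ 2 with hY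
  have hV0 : 0 ≤ V := by simpa using hV ∅
  have hX0 : ∀ p, 0 ≤ X p := fun p => Finset.sum_nonneg fun _ _ => sq_nonneg _
  have hY0 : ∀ p g, 0 ≤ Y p g := fun p g => Finset.sum_nonneg fun _ _ => sq_nonneg _
  have step1 : ∀ g ∈ F, (∑ a ∈ S, u a * v (a⁻¹ * g)) ^ 2 ≤ K * ∑ p ∈ P, X p * Y p g := by
    intro g hg
    rw [← Finset.sum_fiberwise_of_maps_to (s := S) (t := S.image fun a => κ a g)
      (g := fun a => κ a g) (fun a ha => Finset.mem_image_of_mem _ ha)]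
    refine (sq_sum_le_card_mul_sum_sq).trans ?_
    have h1 : ∑ p ∈ S.image (fun a => κ a g), (∑ a ∈ S with κ a g = p, u a * v (a⁻¹ * g)) ^ 2 ≤
        ∑ p ∈ P, X p * Y p g := by
      refine (Finset.sum_le_sum fun p _ => ?_).trans
        (Finset.sum_le_sum_of_subset_of_nonneg ?_ fun p _ _ => mul_nonneg (hX0 p) (hY0 p g))
      · refine (Finset.sum_mul_sq_le_sq_mul_sq _ _ _).trans ?_
        refine mul_le_mul_of_nonneg_right ?_ (hY0 p g)
        refine Finset.sum_le_sum_of_subset_of_nonneg ?_ fun _ _ _ => sq_nonneg _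
        intro a ha
        obtain ⟨ha, hap⟩ := Finset.mem_filter.1 ha
        exact Finset.mem_filter.2 ⟨ha, Finset.mem_image.2 ⟨g, hg, hap⟩⟩
      · intro p hp
        obtain ⟨a, ha, rfl⟩ := Finset.mem_image.1 hp
        exact hmem a ha g hg
    gcongr
    exact hK' g hg
  have step2 : ∀ p, ∑ g ∈ F, Y p g ≤ M * V := by
    intro p
    set Q : Finset (G × G) := (F ×ˢ S).filter fun q => κ q.2 q.1 = p with hQ
    have e1 : ∑ g ∈ F, Y p g = ∑ q ∈ Q, v (q.2⁻¹ * q.1) ^ 2 := by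
      rw [hQ, Finset.sum_filter, Finset.sum_product]
      exact Finset.sum_congr rfl fun g _ => Finset.sum_filter _ _
    rw [e1, ← Finset.sum_fiberwise_of_maps_to (s := Q) (t := Q.image fun q => q.2⁻¹ * q.1)
      (g := fun q => q.2⁻¹ * q.1) (fun a ha => Finset.mem_image_of_mem _ ha)]
    refine le_trans (Finset.sum_le_sum (g := fun b => M * v b ^ 2) fun b _ => ?_) ?_
    · rw [Finset.sum_congr rfl (g := fun _ => v b ^ 2)
        (fun q hq => by rw [(Finset.mem_filter.1 hq).2]), Finset.sum_const, nsmul_eq_mul]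
      refine mul_le_mul_of_nonneg_right ?_ (sq_nonneg _)
      have : (Q.filter fun q => q.2⁻¹ * q.1 = b).card ≤ (C b).card := by
        refine Finset.card_le_card_of_injOn (fun q => p⁻¹ * q.2) ?_ ?_
        · intro q hq
          obtain ⟨hq, hqb⟩ := Finset.mem_filter.1 hq
          obtain ⟨hq, hqp⟩ := Finset.mem_filter.1 hq
          obtain ⟨h1, h2⟩ := Finset.mem_product.1 hq
          subst hqb hqp
          exact hκC _ h2 _ h1
        · intro q hq q' hq' h
          have h1 := (Finset.mem_filter.1 hq).2
          have h2 := (Finset.mem_filter.1 hq').2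
          have h3 : q.2 = q'.2 := mul_left_cancel h
          rw [← h2, h3] at h1
          exact Prod.ext (mul_left_cancel h1) h3
      exact_mod_cast this.trans (hC b)
    · rw [← Finset.mul_sum]
      exact mul_le_mul_of_nonneg_left (hV _) (Nat.cast_nonneg _)
  have step3 : ∑ p ∈ P, X p ≤ K * ∑ a ∈ S, u a ^ 2 := by
    simp only [hX, Finset.sum_filter]
    rw [Finset.sum_comm, Finset.mul_sum]
    refine Finset.sum_le_sum fun a ha => ?_
    rw [← Finset.sum_filter, Finset.sum_const, nsmul_eq_mul]
    refine mul_le_mul_of_nonneg_right ?_ (sq_nonneg _)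
    have : (P.filter fun p => p ∈ F.image (κ a)).card ≤ (F.image (κ a)).card :=
      Finset.card_le_card fun p hp => (Finset.mem_filter.1 hp).2
    exact_mod_cast this.trans (hK a ha)
  calc ∑ g ∈ F, (∑ a ∈ S, u a * v (a⁻¹ * g)) ^ 2
      ≤ ∑ g ∈ F, K * ∑ p ∈ P, X p * Y p g := Finset.sum_le_sum step1
    _ = K * ∑ p ∈ P, X p * ∑ g ∈ F, Y p g := by
        rw [← Finset.mul_sum, Finset.sum_comm]
        simp only [Finset.mul_sum]
    _ ≤ K * ∑ p ∈ P, X p * (M * V) := by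
        refine mul_le_mul_of_nonneg_left (Finset.sum_le_sum fun p _ => ?_) (Nat.cast_nonneg _)
        exact mul_le_mul_of_nonneg_left (step2 p) (hX0 p)
    _ = K * ((∑ p ∈ P, X p) * (M * V)) := by rw [Finset.sum_mul]
    _ ≤ K * ((K * ∑ a ∈ S, u a ^ 2) * (M * V)) := by gcongr
    _ = K ^ 2 * M * (∑ a ∈ S, u a ^ 2) * V := by ring

/-- The triangle inequality replaces `x` and `ξ` by their absolute values, and the real estimate
applies on every finite set of coordinates. -/
lemma regularNorm_le_of_factorization {G : Type*} [Group G] [DecidableEq G]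
    (x : MonoidAlgebra ℂ G) (κ : G → G → G) (K M : ℕ) (C : G → Finset G)
    (hK : ∀ a ∈ x.coeff.support, ∀ F : Finset G, (F.image (κ a)).card ≤ K)
    (hK' : ∀ g, (x.coeff.support.image fun a => κ a g).card ≤ K)
    (hC : ∀ b, (C b).card ≤ M)
    (hκC : ∀ a ∈ x.coeff.support, ∀ g, (κ a g)⁻¹ * a ∈ C (a⁻¹ * g)) :
    regularNorm x ≤ K * Real.sqrt M * twoNorm x := by
  have h0 : 0 ≤ K * Real.sqrt M * twoNorm x :=
    mul_nonneg (mul_nonneg (Nat.cast_nonneg _) (Real.sqrt_nonneg _)) (Real.sqrt_nonneg _)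
  refine ContinuousLinearMap.opNorm_le_bound _ h0 fun ξ => ?_
  refine norm_le_of_sum_norm_sq_le (mul_nonneg h0 (norm_nonneg _)) fun F => ?_
  have h := sum_sq_convolution_le x.coeff.support F κ K M C (fun a => ‖x.coeff a‖) (fun b => ‖ξ b‖)
    (‖ξ‖ ^ 2) (fun a ha => hK a ha F) (fun g _ => hK' g) hC (fun a ha g _ => hκC a ha g)
    (sum_norm_sq_le_norm_sq ξ)
  have e : (K * Real.sqrt M * twoNorm x * ‖ξ‖) ^ 2 =
      K ^ 2 * M * (∑ a ∈ x.coeff.support, ‖x.coeff a‖ ^ 2) * ‖ξ‖ ^ 2 := by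
    rw [mul_pow, mul_pow, mul_pow, Real.sq_sqrt (Nat.cast_nonneg _), twoNorm,
      Real.sq_sqrt (Finset.sum_nonneg fun _ _ => sq_nonneg _)]
  rw [e]
  refine (Finset.sum_le_sum fun g _ => ?_).trans h
  rw [lift_leftRegular_apply]
  gcongr
  refine (norm_sum_le _ _).trans_eq ?_
  simp only [norm_mul]

end Convolution

/-! ### The Haagerup-type inequality for free products -/

section FreeProduct

variable {ι : Type*} {G : ι → Type*} [∀ i, Group (G i)] [DecidableEq ι] [∀ i, DecidableEq (G i)]

/-- The candidates for a factor `c` cancelling against a product `b = c⁻¹ d`: inverses of prefixes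
of `b`, multiplied by an element of a prescribed finite subset of the factor of the next syllable. -/
def cancellingFactors (E : ∀ i, Finset (G i)) (N : ℕ) (b : CoprodI G) : Finset (CoprodI G) :=
  (Finset.range (N + 1)).biUnion fun r =>
    match (syllables b)[r]? with
    | none => {(listProd ((syllables b).take r))⁻¹}
    | some l => (E l.1).image fun s => CoprodI.of s * (listProd ((syllables b).take r))⁻¹

lemma card_cancellingFactors_le (E : ∀ i, Finset (G i)) (N B : ℕ) (hB : 1 ≤ B)
    (hE : ∀ i, (E i).card ≤ B) (b : CoprodI G) :
    (cancellingFactors E N b).card ≤ (N + 1) * B := by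
  refine (Finset.card_biUnion_le_card_mul _ _ B fun r _ => ?_).trans_eq (by simp)
  cases (syllables b)[r]? with
  | none => simpa using hB
  | some l => exact Finset.card_image_le.trans (hE _)

lemma mem_cancellingFactors_of_take {E : ∀ i, Finset (G i)} {N r : ℕ} (hr : r ≤ N)
    (hE : ∀ i, 1 ∈ E i) {b : CoprodI G} :
    (listProd ((syllables b).take r))⁻¹ ∈ cancellingFactors E N b := by
  refine Finset.mem_biUnion.2 ⟨r, Finset.mem_range.2 (by omega), ?_⟩
  cases (syllables b)[r]? with
  | none => simp
  | some l => exact Finset.mem_image.2 ⟨1, hE _, by simp⟩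

lemma mem_cancellingFactors_of_getElem? {E : ∀ i, Finset (G i)} {N r : ℕ} (hr : r ≤ N)
    {b : CoprodI G} {i : ι} {t : G i} (hb : (syllables b)[r]? = some ⟨i, t⟩) {s : G i}
    (hs : s ∈ E i) :
    CoprodI.of s * (listProd ((syllables b).take r))⁻¹ ∈ cancellingFactors E N b := by
  refine Finset.mem_biUnion.2 ⟨r, Finset.mem_range.2 (by omega), ?_⟩
  rw [hb]
  exact Finset.mem_image.2 ⟨s, hs, rfl⟩

/-- Here `P` is the common prefix and `C` the word of `(listProd P)⁻¹ * a`. Without merging, `C⁻¹`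
is a prefix of the word of `a⁻¹ * g`. With merging this holds only for the tail of `C`, and the
leading syllable `s` has to be guessed from `E`. -/
lemma exists_factorization (E : ∀ i, Finset (G i)) (N : ℕ) (hE : ∀ i, 1 ∈ E i) (a g : CoprodI G) :
    ∃ P C D, syllables a = P ++ C ∧ syllables g = P ++ D ∧
      ((syllables a).length ≤ N → (∀ l ∈ syllables a, l.2 ∈ E l.1) →
        (listProd P)⁻¹ * a ∈ cancellingFactors E N (a⁻¹ * g)) := by
  obtain ⟨P, C, D, ha, hg, h⟩ := exists_syllables_inv_mul a g
  refine ⟨P, C, D, ha, hg, fun hN hmem => ?_⟩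
  have hc : (listProd P)⁻¹ * a = listProd C := by
    rw [inv_mul_eq_iff_eq_mul, ← listProd_append, ← ha, listProd_syllables]
  rw [ha, List.length_append] at hN
  rw [hc]
  rcases h with h | ⟨i, s, t, C', D', rfl, rfl, h⟩
  · have := mem_cancellingFactors_of_take (r := C.length) (by omega) hE (b := a⁻¹ * g) (N := N)
    rwa [h, List.take_left' (length_invList C), listProd_invList, inv_inv] at this
  · have := mem_cancellingFactors_of_getElem? (E := E) (r := C'.length) (b := a⁻¹ * g) (N := N)
      (i := i) (t := s⁻¹ * t) (s := s)
      (by simp only [List.length_cons] at hN; omega) (by rw [h]; simp [length_invList])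
      (hmem ⟨i, s⟩ (by simp [ha]))
    rwa [h, List.take_left' (length_invList C'), listProd_invList, inv_inv, ← listProd_cons ⟨i, s⟩]
      at this

/-- Haagerup-type inequality for a free product: elements with at most `N` syllables, all of them
from finite sets of cardinality at most `B`. -/
theorem regularNorm_le_of_syllables (E : ∀ i, Finset (G i)) (N B : ℕ) (hE1 : ∀ i, 1 ∈ E i)
    (hE : ∀ i, (E i).card ≤ B) (hB : 1 ≤ B) (x : MonoidAlgebra ℂ (CoprodI G))
    (hN : ∀ a ∈ x.coeff.support, (syllables a).length ≤ N)
    (hmem : ∀ a ∈ x.coeff.support, ∀ l ∈ syllables a, l.2 ∈ E l.1) :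
    regularNorm x ≤ (N + 1 : ℕ) * Real.sqrt ((N + 1) * B : ℕ) * twoNorm x := by
  choose P C D ha hg h using exists_factorization (G := G) E N hE1
  have key : ∀ L : List (Σ i, G i),
      ((Finset.range (N + 1)).image fun r => listProd (L.take r)).card ≤ N + 1 := fun L =>
    Finset.card_image_le.trans_eq (Finset.card_range _)
  refine regularNorm_le_of_factorization x (fun a g => listProd (P a g)) (N + 1) _
    (cancellingFactors E N) ?_ ?_ (card_cancellingFactors_le E N B hB hE) ?_
  · intro a hax F
    refine (Finset.card_le_card ?_).trans (key (syllables a))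
    intro p hp
    obtain ⟨g, _, rfl⟩ := Finset.mem_image.1 hp
    have h1 := hN a hax
    rw [ha a g, List.length_append] at h1
    refine Finset.mem_image.2 ⟨(P a g).length, Finset.mem_range.2 (by omega), ?_⟩
    simp only [ha a g, List.take_left']
  · intro g
    refine (Finset.card_le_card ?_).trans (key (syllables g))
    intro p hp
    obtain ⟨a, hax, rfl⟩ := Finset.mem_image.1 hp
    have h1 := hN a hax
    rw [ha a g, List.length_append] at h1
    refine Finset.mem_image.2 ⟨(P a g).length, Finset.mem_range.2 (by omega), ?_⟩
    simp only [hg a g, List.take_left']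
  · intro a hax g
    exact h a g (hN a hax) (hmem a hax)

end FreeProduct

/-! ### The length function and subexponential decay -/

section Length

variable {f : ℕ → ℕ}

lemma freeProdLength_eq (f : ℕ → ℕ) (g : FreeProdZ) :
    freeProdLength f g = (((syllables g).map (syllableLength f)).sum : ℕ) := rfl

lemma syllableLength_inv (f : ℕ → ℕ) (n : ℕ+) (s : ZPow n) :
    syllableLength f ⟨n, s⁻¹⟩ = syllableLength f ⟨n, s⟩ := by
  simp [syllableLength]

lemma syllableLength_mul_le (f : ℕ → ℕ) (n : ℕ+) (s t : ZPow n) :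
    syllableLength f ⟨n, s * t⟩ ≤ syllableLength f ⟨n, s⟩ + syllableLength f ⟨n, t⟩ := by
  simp only [syllableLength, ← mul_add, ← Finset.sum_add_distrib]
  gcongr with i _
  exact Int.natAbs_add_le _ _

lemma sum_syllableLength_invList (f : ℕ → ℕ) (L : List (Σ n : ℕ+, ZPow n)) :
    ((invList L).map (syllableLength f)).sum = (L.map (syllableLength f)).sum := by
  induction L with
  | nil => rfl
  | cons a L ih =>
    rw [invList_cons, List.map_append, List.sum_append, ih, List.map_cons, List.sum_cons]
    simp [syllableLength_inv, add_comm]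

lemma freeProdLength_inv (f : ℕ → ℕ) (g : FreeProdZ) :
    freeProdLength f g⁻¹ = freeProdLength f g := by
  rw [freeProdLength_eq, freeProdLength_eq, syllables_inv, sum_syllableLength_invList]

/-- Common prefixes only disappear, and a merged syllable is controlled by subadditivity inside its
factor. The form `g⁻¹ * h` is the one for which the reduced word is known. -/
lemma freeProdLength_inv_mul_le (f : ℕ → ℕ) (g h : FreeProdZ) :
    freeProdLength f (g⁻¹ * h) ≤ freeProdLength f g + freeProdLength f h := by
  simp only [freeProdLength_eq]
  norm_cast
  obtain ⟨P, C, D, hg, hh, H | ⟨i, s, t, C', D', rfl, rfl, H⟩⟩ := exists_syllables_inv_mul g h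
  · simp only [hg, hh, H, List.map_append, List.sum_append, sum_syllableLength_invList]
    omega
  · simp only [hg, hh, H, List.map_append, List.sum_append, sum_syllableLength_invList,
      List.map_cons, List.sum_cons]
    have := syllableLength_mul_le f i s⁻¹ t
    rw [syllableLength_inv] at this
    omega

lemma isLengthFunction_freeProdLength (f : ℕ → ℕ) : IsLengthFunction (freeProdLength f) where
  nonneg g := Nat.cast_nonneg _
  map_one := by rw [freeProdLength_eq, syllables_one]; simp
  map_inv := freeProdLength_inv f
  map_mul_le g h := by
    have := freeProdLength_inv_mul_le f g⁻¹ h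
    rwa [inv_inv, freeProdLength_inv] at this

lemma le_of_strictMonoOn (hf : StrictMonoOn f (Set.Ici 1)) (hf1 : f 1 = 1) {n : ℕ} (hn : 1 ≤ n) :
    n ≤ f n := by
  induction n, hn using Nat.le_induction with
  | base => exact hf1.ge
  | succ n hn ih =>
    have : f n < f (n + 1) := hf (Set.mem_Ici.2 hn) (Set.mem_Ici.2 (hn.trans n.le_succ)) (Nat.lt_add_one n)
    omega

lemma le_floorInverse (hf : StrictMonoOn f (Set.Ici 1)) (hf1 : f 1 = 1) {n N : ℕ} (hn : 1 ≤ n)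
    (h : f n ≤ N) : n ≤ floorInverse f N :=
  le_csSup ⟨N, fun _ hk => (le_of_strictMonoOn hf hf1 hk.1).trans hk.2⟩ ⟨hn, h⟩

lemma exists_natAbs_pos {n : ℕ+} {s : ZPow n} (hs : s ≠ 1) :
    ∃ i, 1 ≤ (Multiplicative.toAdd s i).natAbs := by
  by_contra! h
  refine hs (Multiplicative.toAdd.injective (funext fun i => ?_))
  have := h i
  simp only [toAdd_one, Pi.zero_apply]
  omega

lemma natAbs_le_sum {n : ℕ+} (s : ZPow n) (i : Fin n) :
    (Multiplicative.toAdd s i).natAbs ≤ ∑ j, (Multiplicative.toAdd s j).natAbs :=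
  Finset.single_le_sum (f := fun j => (Multiplicative.toAdd s j).natAbs)
    (fun _ _ => Nat.zero_le _) (Finset.mem_univ i)

lemma le_syllableLength {n : ℕ+} {s : ZPow n} (hs : s ≠ 1) :
    f n ≤ syllableLength f ⟨n, s⟩ := by
  obtain ⟨i, hi⟩ := exists_natAbs_pos hs
  exact Nat.le_mul_of_pos_right _ (hi.trans (natAbs_le_sum s i))

lemma syllableLength_le {g : FreeProdZ} {N : ℕ} (hg : freeProdLength f g ≤ N)
    {l : Σ n : ℕ+, ZPow n} (hl : l ∈ syllables g) : syllableLength f l ≤ N := by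
  rw [freeProdLength_eq] at hg
  have h := List.single_le_sum (l := (syllables g).map (syllableLength f)) (by simp) _
    (List.mem_map_of_mem hl)
  exact h.trans (by exact_mod_cast hg)

lemma length_syllables_le (hpos : ∀ n : ℕ+, 1 ≤ f n) {g : FreeProdZ} {N : ℕ}
    (hg : freeProdLength f g ≤ N) : (syllables g).length ≤ N := by
  rw [freeProdLength_eq] at hg
  have h := List.length_le_sum_of_one_le ((syllables g).map (syllableLength f)) (by
    intro k hk
    obtain ⟨⟨n, s⟩, hl, rfl⟩ := List.mem_map.1 hk
    exact (hpos n).trans (le_syllableLength ((isReducedList_syllables g).1 _ hl)))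
  rw [List.length_map] at h
  exact h.trans (by exact_mod_cast hg)

/-- The box of elements of `ℤⁿ` with coordinates of absolute value at most `N`, provided that the
generators have length at most `N`; otherwise only the identity. -/
noncomputable def syllableBox (f : ℕ → ℕ) (N : ℕ) (n : ℕ+) : Finset (ZPow n) :=
  if f n ≤ N then
    (Fintype.piFinset fun _ : Fin (n : ℕ) => Finset.Icc (-(N : ℤ)) N).map
      Multiplicative.ofAdd.toEmbedding
  else {1}

lemma one_mem_syllableBox (f : ℕ → ℕ) (N : ℕ) (n : ℕ+) : 1 ∈ syllableBox f N n := by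
  rw [syllableBox]
  split_ifs
  · exact Finset.mem_map.2 ⟨0, Fintype.mem_piFinset.2 fun i => by simp, rfl⟩
  · simp

/-- The bound is uniform in `n`: factors with `f n ≤ N` have rank at most `floorInverse f N`, and
all others contribute a singleton. -/
lemma card_syllableBox_le (hf : StrictMonoOn f (Set.Ici 1)) (hf1 : f 1 = 1) (N : ℕ) (n : ℕ+) :
    (syllableBox f N n).card ≤ (2 * N + 1) ^ floorInverse f N := by
  rw [syllableBox]
  split_ifs with h
  · rw [Finset.card_map, Fintype.card_piFinset]
    simp only [Int.card_Icc, Finset.prod_const, Finset.card_univ, Fintype.card_fin]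
    rw [show ((N : ℤ) + 1 - -N).toNat = 2 * N + 1 by omega]
    exact Nat.pow_le_pow_right (by omega) (le_floorInverse hf hf1 n.2 h)
  · simpa using Nat.one_le_pow _ _ (by omega)

lemma mem_syllableBox {N : ℕ} {n : ℕ+} {s : ZPow n} (hpos : 1 ≤ f n) (hs : s ≠ 1)
    (h : syllableLength f ⟨n, s⟩ ≤ N) : s ∈ syllableBox f N n := by
  rw [syllableBox, if_pos ((le_syllableLength hs).trans h)]
  refine Finset.mem_map.2 ⟨Multiplicative.toAdd s, Fintype.mem_piFinset.2 fun i => ?_, rfl⟩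
  have h1 := natAbs_le_sum s i
  have h2 : ∑ j, (Multiplicative.toAdd s j).natAbs ≤ N := (Nat.le_mul_of_pos_left _ hpos).trans h
  rw [Finset.mem_Icc]
  omega

/-- A decay function for the free product of the groups `ℤⁿ`. -/
noncomputable def freeProdDecay (f : ℕ → ℕ) (N : ℕ) : ℝ :=
  (N + 1 : ℕ) * Real.sqrt ((N + 1) * (2 * N + 1) ^ floorInverse f N : ℕ)

lemma isDecayFunction_freeProdDecay (hf : StrictMonoOn f (Set.Ici 1)) (hf1 : f 1 = 1) :
    IsDecayFunction (freeProdLength f) (freeProdDecay f) := by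
  intro N x hx
  have hpos : ∀ n : ℕ+, 1 ≤ f n := fun n => (Nat.succ_le_of_lt n.2).trans (le_of_strictMonoOn hf hf1 n.2)
  exact regularNorm_le_of_syllables (syllableBox f N) N _ (one_mem_syllableBox f N)
    (card_syllableBox_le hf hf1 N) (Nat.one_le_pow _ _ (by omega)) x
    (fun a ha => length_syllables_le hpos (hx a ha))
    (fun a ha l hl => mem_syllableBox (hpos l.1) ((isReducedList_syllables a).1 _ hl)
      (syllableLength_le (hx a ha) hl))

lemma freeProdDecay_pos (f : ℕ → ℕ) (N : ℕ) : 0 < freeProdDecay f N := by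
  unfold freeProdDecay
  positivity

lemma log_freeProdDecay (f : ℕ → ℕ) (N : ℕ) :
    Real.log (freeProdDecay f N) =
      3 / 2 * Real.log (N + 1) + floorInverse f N / 2 * Real.log (2 * N + 1) := by
  unfold freeProdDecay
  push_cast
  rw [Real.log_mul (by positivity) (by positivity), Real.log_sqrt (by positivity),
    Real.log_mul (by positivity) (by positivity), Real.log_pow]
  ring

lemma isSubexponential_freeProdDecay
    (hinv : (fun N : ℕ => (floorInverse f N : ℝ)) =o[atTop]
      fun N : ℕ => (N : ℝ) / Real.log (N : ℝ)) : IsSubexponential (freeProdDecay f) := by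
  refine ⟨fun N => (freeProdDecay_pos f N).le, ?_⟩
  -- For `N ≥ 3` one has `2N + 1 ≤ N²`, whence the constant `2`.
  have hlog : (fun N : ℕ => Real.log (2 * N + 1)) =O[atTop] fun N : ℕ => Real.log N := by
    refine IsBigO.of_bound 2 ?_
    filter_upwards [eventually_ge_atTop 3] with N hN
    have hN' : (3 : ℝ) ≤ N := by exact_mod_cast hN
    rw [Real.norm_of_nonneg (Real.log_nonneg (by linarith)),
      Real.norm_of_nonneg (Real.log_nonneg (by linarith)), ← Nat.cast_ofNat (R := ℝ),
      ← Real.log_pow]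
    refine Real.log_le_log (by positivity) ?_
    norm_num
    nlinarith
  have hN1 : (fun N : ℕ => Real.log (N + 1)) =o[atTop] fun N : ℕ => (N : ℝ) := by
    have h1 : (fun N : ℕ => Real.log (N + 1)) =O[atTop] fun N : ℕ => Real.log N := by
      refine IsBigO.trans (IsBigO.of_bound 1 (Eventually.of_forall fun N => ?_)) hlog
      have hN' : (0 : ℝ) ≤ N := Nat.cast_nonneg _
      rw [Real.norm_of_nonneg (Real.log_nonneg (by linarith)),
        Real.norm_of_nonneg (Real.log_nonneg (by linarith)), one_mul]
      exact Real.log_le_log (by linarith) (by linarith)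
    exact h1.trans_isLittleO (Real.isLittleO_log_id_atTop.comp_tendsto tendsto_natCast_atTop_atTop)
  have hm : (fun N : ℕ => (floorInverse f N : ℝ) * Real.log (2 * N + 1)) =o[atTop]
      fun N : ℕ => (N : ℝ) := by
    refine (hinv.mul_isBigO hlog).congr' EventuallyEq.rfl ?_
    filter_upwards [eventually_ge_atTop 3] with N hN
    have hN' : (3 : ℝ) ≤ N := by exact_mod_cast hN
    have := (Real.log_pos (show (1 : ℝ) < N by linarith)).ne'
    field_simp
  have hsum : (fun N : ℕ => Real.log (freeProdDecay f N)) =o[atTop] fun N : ℕ => (N : ℝ) := by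
    refine ((hN1.const_mul_left (3 / 2)).add (hm.const_mul_left (1 / 2))).congr_left fun N => ?_
    rw [log_freeProdDecay]
    ring
  have h := (Real.continuous_exp.tendsto 0).comp hsum.tendsto_div_nhds_zero
  rw [Real.exp_zero] at h
  refine h.congr fun N => ?_
  rw [Function.comp_apply, Real.rpow_def_of_pos (freeProdDecay_pos f N), mul_one_div]

theorem hasSD_freeProdLength (hf : StrictMonoOn f (Set.Ici 1)) (hf1 : f 1 = 1)
    (hinv : (fun N : ℕ => (floorInverse f N : ℝ)) =o[atTop]
      fun N : ℕ => (N : ℝ) / Real.log (N : ℝ)) :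
    HasSDWithRespectTo (freeProdLength f) :=
  ⟨isLengthFunction_freeProdLength f, freeProdDecay f, isSubexponential_freeProdDecay hinv,
    isDecayFunction_freeProdDecay hf hf1⟩

end Length

/-! ### Failure of rapid decay -/

section Growth

/-- The indicator function of a finite subset, as an element of the group algebra. -/
noncomputable def indicatorAlgebra {G : Type*} (B : Finset G) : MonoidAlgebra ℂ G :=
  MonoidAlgebra.ofCoeff (Finsupp.indicator B fun _ _ => 1)

lemma coeff_indicatorAlgebra {G : Type*} [DecidableEq G] (B : Finset G) (g : G) :
    (indicatorAlgebra B).coeff g = if g ∈ B then 1 else 0 := by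
  simp [indicatorAlgebra, Finsupp.indicator_apply]

lemma support_indicatorAlgebra {G : Type*} (B : Finset G) : (indicatorAlgebra B).coeff.support = B := by
  classical
  ext g
  simp [coeff_indicatorAlgebra]

variable {G : Type*} [Group G]

lemma twoNorm_indicatorAlgebra (B : Finset G) : twoNorm (indicatorAlgebra B) = √(B.card : ℝ) := by
  classical
  rw [twoNorm, support_indicatorAlgebra,
    Finset.sum_congr rfl (g := fun _ => (1 : ℝ)) fun g hg => by simp [coeff_indicatorAlgebra, hg]]
  simp

/-- The indicator function of a finite subset, as an element of `ℓ²`. -/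
noncomputable def indicatorEllTwo {G : Type*} (B : Finset G) : EllTwo G :=
  open scoped Classical in ∑ g ∈ B, lp.single 2 g (1 : ℂ)

lemma indicatorEllTwo_apply {G : Type*} [DecidableEq G] (B : Finset G) (g : G) :
    (indicatorEllTwo B : EllTwo G) g = if g ∈ B then 1 else 0 := by
  rw [indicatorEllTwo, lp.coeFn_sum, Finset.sum_apply]
  simp only [lp.single_apply, Pi.single_apply]
  convert Finset.sum_ite_eq B g fun _ => (1 : ℂ)

lemma norm_indicatorEllTwo_le {G : Type*} (B : Finset G) : ‖indicatorEllTwo B‖ ≤ √(B.card : ℝ) := by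
  classical
  refine norm_le_of_sum_norm_sq_le (Real.sqrt_nonneg _) fun F => ?_
  rw [Real.sq_sqrt (Nat.cast_nonneg _)]
  calc ∑ g ∈ F, ‖indicatorEllTwo B g‖ ^ 2 = ∑ g ∈ F, if g ∈ B then (1 : ℝ) else 0 := by
        refine Finset.sum_congr rfl fun g _ => ?_
        rw [indicatorEllTwo_apply]
        split_ifs <;> simp
    _ = (F.filter (· ∈ B)).card := by rw [Finset.sum_boole]
    _ ≤ B.card := by
        exact_mod_cast Finset.card_le_card fun g hg => (Finset.mem_filter.1 hg).2

/-- Lower bound for the norm of an indicator function by the doubling of the set. -/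
lemma card_sq_le_regularNorm_sq_mul [DecidableEq G] (B T : Finset G)
    (hT : ∀ a ∈ B, ∀ b ∈ B, a * b ∈ T) (hB : B.Nonempty) :
    (B.card : ℝ) ^ 3 ≤ regularNorm (indicatorAlgebra B) ^ 2 * T.card := by
  set Λ := MonoidAlgebra.lift ℂ (EllTwo G →L[ℂ] EllTwo G) G (leftRegular G) (indicatorAlgebra B)
  set η : EllTwo G := Λ (indicatorEllTwo B) with hη
  have happ : ∀ g, η g = ((B.filter fun a => a⁻¹ * g ∈ B).card : ℂ) := by
    intro g
    rw [hη, lift_leftRegular_apply, support_indicatorAlgebra, Finset.card_filter, Nat.cast_sum]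
    refine Finset.sum_congr rfl fun a ha => ?_
    rw [coeff_indicatorAlgebra, if_pos ha, indicatorEllTwo_apply, one_mul]
    split_ifs <;> simp
  have hcount : ∑ g ∈ T, (B.filter fun a => a⁻¹ * g ∈ B).card = B.card ^ 2 := by
    simp only [Finset.card_filter]
    rw [Finset.sum_comm, sq, ← smul_eq_mul, ← Finset.sum_const]
    refine Finset.sum_congr rfl fun a ha => ?_
    rw [← Finset.card_filter]
    symm
    refine Finset.card_bij (fun b _ => a * b) ?_ ?_ ?_
    · intro b hb
      simpa [hb] using hT a ha b hb
    · intro b _ b' _ h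
      exact mul_left_cancel h
    · intro g hg
      exact ⟨a⁻¹ * g, (Finset.mem_filter.1 hg).2, by group⟩
  -- The values of `η` count factorizations `g = a b` in `B`, with total `|B|²` over `T`;
  -- Cauchy–Schwarz on `T` turns this into a lower bound for `‖η‖`.
  have h1 : ((B.card : ℝ) ^ 2) ^ 2 ≤ T.card * ‖η‖ ^ 2 := by
    have hs : (B.card : ℝ) ^ 2 = ∑ g ∈ T, ‖η g‖ := by
      simp only [happ, Complex.norm_natCast]
      exact_mod_cast hcount.symm
    rw [hs]
    refine sq_sum_le_card_mul_sum_sq.trans ?_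
    gcongr
    exact sum_norm_sq_le_norm_sq η T
  have h2 : ‖η‖ ^ 2 ≤ regularNorm (indicatorAlgebra B) ^ 2 * B.card := by
    have h3 : ‖η‖ ≤ regularNorm (indicatorAlgebra B) * √(B.card : ℝ) :=
      (Λ.le_opNorm _).trans
        (mul_le_mul_of_nonneg_left (norm_indicatorEllTwo_le B) (norm_nonneg _))
    calc ‖η‖ ^ 2 ≤ (regularNorm (indicatorAlgebra B) * √(B.card : ℝ)) ^ 2 := by gcongr
      _ = _ := by rw [mul_pow, Real.sq_sqrt (Nat.cast_nonneg _)]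
  have hpos : (0 : ℝ) < B.card := by exact_mod_cast hB.card_pos
  refine le_of_mul_le_mul_right ?_ hpos
  calc (B.card : ℝ) ^ 3 * B.card = ((B.card : ℝ) ^ 2) ^ 2 := by ring
    _ ≤ T.card * ‖η‖ ^ 2 := h1
    _ ≤ T.card * (regularNorm (indicatorAlgebra B) ^ 2 * B.card) := by gcongr
    _ = _ := by ring

lemma card_sq_le_of_isDecayFunction [DecidableEq G] {l : G → ℝ} {d : ℕ → ℝ}
    (hd : IsDecayFunction l d)
    {N : ℕ} (B T : Finset G) (hT : ∀ a ∈ B, ∀ b ∈ B, a * b ∈ T) (hB : B.Nonempty)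
    (hN : ∀ a ∈ B, l a ≤ N) : (B.card : ℝ) ^ 2 ≤ d N ^ 2 * T.card := by
  have h1 := card_sq_le_regularNorm_sq_mul B T hT hB
  have h2 := hd N (indicatorAlgebra B) (by rwa [support_indicatorAlgebra])
  rw [twoNorm_indicatorAlgebra] at h2
  have h3 : regularNorm (indicatorAlgebra B) ^ 2 ≤ d N ^ 2 * B.card := by
    calc regularNorm (indicatorAlgebra B) ^ 2 ≤ (d N * √(B.card : ℝ)) ^ 2 :=
          pow_le_pow_left₀ (norm_nonneg _) h2 2
      _ = _ := by rw [mul_pow, Real.sq_sqrt (Nat.cast_nonneg _)]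
  have hpos : (0 : ℝ) < B.card := by exact_mod_cast hB.card_pos
  refine le_of_mul_le_mul_right ?_ hpos
  calc (B.card : ℝ) ^ 2 * B.card = (B.card : ℝ) ^ 3 := by ring
    _ ≤ regularNorm (indicatorAlgebra B) ^ 2 * T.card := h1
    _ ≤ (d N ^ 2 * B.card) * T.card := by gcongr
    _ = _ := by ring

lemma IsLengthFunction.map_pow_le {l : G → ℝ} (hl : IsLengthFunction l) (g : G) (n : ℕ) :
    l (g ^ n) ≤ n * l g := by
  induction n with
  | zero => simp [hl.map_one]
  | succ n ih =>
    rw [pow_succ]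
    push_cast
    linarith [hl.map_mul_le (g ^ n) g]

lemma IsLengthFunction.map_prod_le {l : G → ℝ} (hl : IsLengthFunction l) {α A : Type*}
    [CommGroup A] (φ : A →* G) (s : Finset α) (u : α → A) :
    l (φ (∏ i ∈ s, u i)) ≤ ∑ i ∈ s, l (φ (u i)) := by
  classical
  induction s using Finset.induction_on with
  | empty => simp [hl.map_one]
  | insert i s hi ih =>
    rw [Finset.prod_insert hi, Finset.sum_insert hi, map_mul]
    exact (hl.map_mul_le _ _).trans (by linarith)

/-- The box `{0, …, k - 1}ⁿ` in `ℤⁿ`. -/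
noncomputable def natBox (n : ℕ+) (k : ℕ) : Finset (ZPow n) :=
  (Fintype.piFinset fun _ : Fin (n : ℕ) => Finset.Ico (0 : ℤ) k).map Multiplicative.ofAdd.toEmbedding

lemma mem_natBox {n : ℕ+} {k : ℕ} {v : ZPow n} :
    v ∈ natBox n k ↔ ∀ i, 0 ≤ Multiplicative.toAdd v i ∧ Multiplicative.toAdd v i < k := by
  simp only [natBox, Finset.mem_map_equiv, Fintype.mem_piFinset, Finset.mem_Ico]
  rfl

lemma card_natBox (n : ℕ+) (k : ℕ) : (natBox n k).card = k ^ (n : ℕ) := by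
  simp [natBox]

/-- Take `L` above the sum of the lengths of the standard generators. What matters is that `L` does
not depend on `k`, so boxes lie in balls of linearly growing radius. -/
lemma exists_length_le_of_mem_natBox {l : G → ℝ} (hl : IsLengthFunction l) (n : ℕ+)
    (φ : ZPow n →* G) : ∃ L : ℕ, ∀ k, ∀ v ∈ natBox n k, l (φ v) ≤ (L * k : ℕ) := by
  obtain ⟨L, hL⟩ := exists_nat_ge
    (∑ i : Fin (n : ℕ), l (φ (Multiplicative.ofAdd (Pi.single i 1))))
  refine ⟨L, fun k v hv => ?_⟩
  rw [mem_natBox] at hv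
  have hv' : v = ∏ i, (Multiplicative.ofAdd (Pi.single i 1) : ZPow n) ^
      (Multiplicative.toAdd v i).toNat := by
    apply Multiplicative.toAdd.injective
    rw [toAdd_prod]
    funext j
    rw [Finset.sum_apply, Finset.sum_eq_single j]
    · simp [(hv j).1]
    · intro i _ hij
      simp [hij.symm]
    · simp
  rw [hv']
  refine (hl.map_prod_le φ _ _).trans ?_
  calc ∑ i, l (φ ((Multiplicative.ofAdd (Pi.single i 1) : ZPow n) ^
          (Multiplicative.toAdd v i).toNat))
      ≤ ∑ i : Fin (n : ℕ), k * l (φ (Multiplicative.ofAdd (Pi.single i 1))) := by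
        refine Finset.sum_le_sum fun i _ => ?_
        rw [map_pow]
        refine (hl.map_pow_le _ _).trans ?_
        gcongr
        · exact hl.nonneg _
        · have := hv i
          omega
    _ = k * ∑ i : Fin (n : ℕ), l (φ (Multiplicative.ofAdd (Pi.single i 1))) := by
        rw [Finset.mul_sum]
    _ ≤ k * L := by gcongr
    _ = (L * k : ℕ) := by push_cast; ring

/-- A group containing `ℤⁿ` for every `n` does not have property RD. -/
theorem not_hasRD_of_injective_ZPow (φ : ∀ n, ZPow n →* G)
    (hφ : ∀ n, Function.Injective (φ n)) : ¬ HasRD G := by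
  classical
  rintro ⟨l, hl, P, hP⟩
  -- The rank must exceed the degree `2 * P.natDegree` of the square of the decay polynomial.
  set n : ℕ+ := ⟨2 * P.natDegree + 1, by omega⟩ with hn
  obtain ⟨L, hL⟩ := exists_length_le_of_mem_natBox hl n (φ n)
  have key : ∀ k : ℕ, 0 < k → (k : ℝ) ^ (n : ℕ) ≤ 2 ^ (n : ℕ) * P.eval ((L : ℝ) * k) ^ 2 := by
    intro k hk
    have hcard : ∀ k, ((natBox n k).image (φ n)).card = k ^ (n : ℕ) := fun k => by
      rw [Finset.card_image_of_injective _ (hφ n), card_natBox]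
    have h := card_sq_le_of_isDecayFunction hP (N := L * k) ((natBox n k).image (φ n))
      ((natBox n (2 * k)).image (φ n)) ?_ ?_ ?_
    · rw [hcard, hcard] at h
      push_cast at h
      have hpos : (0 : ℝ) < (k : ℝ) ^ (n : ℕ) := by positivity
      refine le_of_mul_le_mul_right ?_ hpos
      calc (k : ℝ) ^ (n : ℕ) * (k : ℝ) ^ (n : ℕ) = ((k : ℝ) ^ (n : ℕ)) ^ 2 := by ring
        _ ≤ _ := h
        _ = _ := by rw [mul_pow]; ring
    · intro a ha b hb
      obtain ⟨a, ha', rfl⟩ := Finset.mem_image.1 ha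
      obtain ⟨b, hb', rfl⟩ := Finset.mem_image.1 hb
      refine Finset.mem_image.2 ⟨a * b, mem_natBox.2 fun i => ?_, map_mul _ _ _⟩
      have h1 := mem_natBox.1 ha' i
      have h2 := mem_natBox.1 hb' i
      rw [toAdd_mul, Pi.add_apply]
      push_cast
      omega
    · exact ⟨φ n 1, Finset.mem_image_of_mem _ (mem_natBox.2 fun i => by simpa using hk)⟩
    · intro a ha
      obtain ⟨a, ha', rfl⟩ := Finset.mem_image.1 ha
      exact hL k a ha'
  set Q : Polynomial ℝ := Polynomial.C (2 ^ (n : ℕ)) * (P.comp (Polynomial.C (L : ℝ) * Polynomial.X)) ^ 2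
  have hdeg : Q.degree < ((Polynomial.X : Polynomial ℝ) ^ (n : ℕ)).degree := by
    rw [Polynomial.degree_X_pow]
    refine lt_of_le_of_lt (Polynomial.degree_le_natDegree) ?_
    norm_cast
    have h1 : Q.natDegree ≤ 2 * P.natDegree := by
      refine (Polynomial.natDegree_C_mul_le _ _).trans ?_
      refine Polynomial.natDegree_pow_le.trans ?_
      gcongr
      refine Polynomial.natDegree_comp_le.trans ?_
      calc P.natDegree * _ ≤ P.natDegree * 1 := by
            gcongr
            exact (Polynomial.natDegree_C_mul_le _ _).trans Polynomial.natDegree_X_le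
        _ = _ := mul_one _
    exact lt_of_le_of_lt h1 (Nat.lt_succ_self _)
  have hlim := (Polynomial.div_tendsto_atTop_zero_of_degree_lt Q _ hdeg).comp
    (tendsto_natCast_atTop_atTop (R := ℝ))
  obtain ⟨k, hk, hk0⟩ := ((hlim.eventually_lt_const zero_lt_one).and (eventually_gt_atTop 0)).exists
  have hpos : (0 : ℝ) < (k : ℝ) ^ (n : ℕ) := by positivity
  simp only [Function.comp_apply, Polynomial.eval_pow, Polynomial.eval_X] at hk
  rw [div_lt_one hpos] at hk
  have := key k hk0
  simp [Q] at hk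
  linarith

theorem not_hasRD_freeProdZ : ¬ HasRD FreeProdZ :=
  not_hasRD_of_injective_ZPow (fun _ => CoprodI.of) CoprodI.of_injective

end Growth

/-! ### Amenable subgroups are abelian -/

section Amenable

lemma IsAmenable.of_surjective {H K : Type*} [Group H] [Group K] (hH : IsAmenable H) (φ : H →* K)
    (hφ : Function.Surjective φ) : IsAmenable K := by
  obtain ⟨m, h0, h1, hadd, hinv⟩ := hH
  refine ⟨fun A => m (φ ⁻¹' A), fun A => h0 _, h1, fun A B hAB => ?_, fun k A => ?_⟩
  · exact hadd _ _ (hAB.preimage φ)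
  · obtain ⟨h, rfl⟩ := hφ k
    refine Eq.trans ?_ (hinv h (φ ⁻¹' A))
    refine congrArg m ?_
    ext x
    constructor
    · rintro ⟨a, ha, hax⟩
      refine ⟨h⁻¹ * x, ?_, by group⟩
      have hax' : φ h * a = φ x := hax
      rw [Set.mem_preimage, map_mul, map_inv, ← hax', inv_mul_cancel_left]
      exact ha
    · rintro ⟨y, hy, rfl⟩
      exact ⟨φ y, hy, (map_mul φ h y).symm⟩

/-- Paradoxical decomposition: words not starting with `c` lie in `c` times the words starting with
`c⁻¹`, so the words starting with `c` or `c⁻¹` have measure at least `1`. Two distinct letters give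
disjoint sets of total measure at least `2`. -/
lemma not_isAmenable_freeGroup {α : Type*} {a b : α} (hab : a ≠ b) :
    ¬ IsAmenable (FreeGroup α) := by
  classical
  rintro ⟨m, h0, h1, hadd, hinv⟩
  have hmono : ∀ A B : Set (FreeGroup α), A ⊆ B → m A ≤ m B := fun A B hAB => by
    have := hadd A (B \ A) Set.disjoint_sdiff_right
    rw [Set.union_sdiff_cancel hAB] at this
    linarith [h0 (B \ A)]
  have hcover : ∀ c : α, 1 ≤ m (FreeGroup.startsWith (c, true)) +
      m (FreeGroup.startsWith (c, false)) := fun c => by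
    have hu := hadd (FreeGroup.startsWith (c, true)) (FreeGroup.startsWith (c, true))ᶜ
      disjoint_compl_right
    rw [Set.union_compl_self, h1] at hu
    rw [hu, ← hinv (FreeGroup.mk [(c, true)]) (FreeGroup.startsWith (c, false))]
    gcongr
    refine hmono _ _ fun g hg => ?_
    refine ⟨FreeGroup.mk [(c, false)] * g, FreeGroup.startsWith_mk_mul g hg, ?_⟩
    have : FreeGroup.mk [(c, false)] = (FreeGroup.mk [(c, true)])⁻¹ := by
      simp [FreeGroup.inv_mk, FreeGroup.invRev]
    simp only [this, mul_inv_cancel_left]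
  have hd : ∀ v w : α × Bool, v ≠ w →
      Disjoint (FreeGroup.startsWith v) (FreeGroup.startsWith w) := fun v w h =>
    FreeGroup.startsWith.disjoint_iff_ne.2 h
  have e1 := hadd _ _ (hd (a, true) (a, false) (by simp))
  have e2 := hadd _ _ (hd (b, true) (b, false) (by simp))
  have e3 := hadd (FreeGroup.startsWith (a, true) ∪ FreeGroup.startsWith (a, false))
    (FreeGroup.startsWith (b, true) ∪ FreeGroup.startsWith (b, false)) (by
      simp only [Set.disjoint_union_left, Set.disjoint_union_right]
      exact ⟨⟨hd _ _ (by simp [hab]), hd _ _ (by simp [hab])⟩,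
        ⟨hd _ _ (by simp [hab]), hd _ _ (by simp [hab])⟩⟩)
  have e4 := hmono (FreeGroup.startsWith (a, true) ∪ FreeGroup.startsWith (a, false) ∪
    (FreeGroup.startsWith (b, true) ∪ FreeGroup.startsWith (b, false))) Set.univ
    (Set.subset_univ _)
  linarith [hcover a, hcover b]

lemma commute_freeGroup_of_subsingleton {α : Type*} [Subsingleton α] (x y : FreeGroup α) :
    Commute x y := by
  induction x using FreeGroup.induction_on with
  | C1 => exact Commute.one_left _
  | of a =>
    induction y using FreeGroup.induction_on with
    | C1 => exact Commute.one_right _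
    | of b => rw [Subsingleton.elim a b]
    | inv_of b h => exact h.inv_right
    | mul u v hu hv => exact hu.mul_right hv
  | inv_of a h => exact h.inv_left
  | mul u v hu hv => exact hu.mul_left hv

lemma IsAmenable.commute_of_isFreeGroup {F : Type*} [Group F] [IsFreeGroup F]
    (hF : IsAmenable F) (x y : F) : Commute x y := by
  have hsub : Subsingleton (IsFreeGroup.Generators F) := by
    by_contra h
    rw [not_subsingleton_iff_nontrivial] at h
    obtain ⟨a, b, hab⟩ := h
    exact not_isAmenable_freeGroup hab (hF.of_surjective (IsFreeGroup.toFreeGroup F).toMonoidHom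
      (IsFreeGroup.toFreeGroup F).surjective)
  exact (commute_freeGroup_of_subsingleton (IsFreeGroup.toFreeGroup F x)
    (IsFreeGroup.toFreeGroup F y)).of_map (IsFreeGroup.toFreeGroup F).injective

/-- With this instance the free product of copies of `ℤ` is recognized as a free group. -/
instance isFreeGroup_multiplicative_int : IsFreeGroup (Multiplicative ℤ) :=
  IsFreeGroup.ofMulEquiv (FreeGroup.mulEquivIntOfUnique (α := Unit))

lemma IsAmenable.commute_of_residuallyFree {G F ι : Type*} [Group G] [Group F] [IsFreeGroup F]
    (φ : ι → G →* F) (hφ : ∀ g : G, g ≠ 1 → ∃ i, φ i g ≠ 1) {H : Subgroup G}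
    (hH : IsAmenable H) {x y : G} (hx : x ∈ H) (hy : y ∈ H) : Commute x y := by
  by_contra hxy
  obtain ⟨i, hi⟩ := hφ (x * y * (y * x)⁻¹) (fun h => hxy (mul_inv_eq_one.1 h))
  refine hi ?_
  rw [map_mul, map_inv, mul_inv_eq_one, map_mul, map_mul]
  have hK : IsAmenable (H.map (φ i)) :=
    hH.of_surjective ((φ i).subgroupMap H) ((φ i).subgroupMap_surjective H)
  -- The image of `H` is itself free, by Nielsen–Schreier.
  have := hK.commute_of_isFreeGroup ⟨φ i x, Subgroup.mem_map_of_mem _ hx⟩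
    ⟨φ i y, Subgroup.mem_map_of_mem _ hy⟩
  exact congrArg Subtype.val this.eq

/-- If no syllable dies, applying the factor maps syllable by syllable keeps the word reduced. -/
lemma coprodI_map_ne_one {ι : Type*} {G G' : ι → Type*} [∀ i, Group (G i)] [∀ i, Group (G' i)]
    [DecidableEq ι] [∀ i, DecidableEq (G i)] [∀ i, DecidableEq (G' i)] (χ : ∀ i, G i →* G' i)
    {g : CoprodI G} (hg : g ≠ 1) (h : ∀ l ∈ syllables g, χ l.1 l.2 ≠ 1) :
    CoprodI.lift (fun i => CoprodI.of.comp (χ i)) g ≠ (1 : CoprodI G') := by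
  have hmap : ∀ L : List (Σ i, G i), CoprodI.lift (fun i => CoprodI.of.comp (χ i)) (listProd L) =
      listProd (L.map fun l => (⟨l.1, χ l.1 l.2⟩ : Σ i, G' i)) := fun L => by
    simp [listProd, map_list_prod, Function.comp_def]
  have hred : IsReducedList ((syllables g).map fun l => (⟨l.1, χ l.1 l.2⟩ : Σ i, G' i)) := by
    refine ⟨?_, ?_⟩
    · intro l hl
      obtain ⟨l, hl', rfl⟩ := List.mem_map.1 hl
      exact h l hl'
    · rw [List.isChain_map]
      exact (isReducedList_syllables g).2
  rw [← listProd_syllables g, hmap]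
  intro h1
  have h2 := syllables_listProd hred
  rw [h1, syllables_one] at h2
  exact hg (syllables_eq_nil.1 (List.map_eq_nil_iff.1 h2.symm))

/-- The homomorphism `v ↦ ∑ vᵢ Nⁱ` from `ℤⁿ` to `ℤ`. -/
def evalHom (N : ℕ) (n : ℕ+) : ZPow n →* Multiplicative ℤ where
  toFun v := Multiplicative.ofAdd (∑ i : Fin (n : ℕ), Multiplicative.toAdd v i * (N : ℤ) ^ (i : ℕ))
  map_one' := by simp
  map_mul' v w := by
    simp [add_mul, Finset.sum_add_distrib]

/-- The coordinates of `v` are the coefficients of a nonzero polynomial, which has only finitely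
many roots `N`. "Eventually" allows one `N` to serve all syllables of a word. -/
lemma eventually_evalHom_ne_one {n : ℕ+} {v : ZPow n} (hv : v ≠ 1) :
    ∀ᶠ N in atTop, evalHom N n v ≠ 1 := by
  set p : Polynomial ℤ :=
    ∑ i : Fin (n : ℕ), Polynomial.C (Multiplicative.toAdd v i) * Polynomial.X ^ (i : ℕ) with hp
  have hp0 : p ≠ 0 := by
    intro h
    refine hv (Multiplicative.toAdd.injective (funext fun j => ?_))
    have := congrArg (fun q => Polynomial.coeff q (j : ℕ)) h
    simp only [hp, Polynomial.finsetSum_coeff, Polynomial.coeff_C_mul_X_pow,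
      Polynomial.coeff_zero] at this
    rw [Finset.sum_eq_single j] at this
    · simpa using this
    · intro i _ hij
      rw [if_neg fun h => hij (Fin.ext h.symm)]
    · simp
  rw [← Nat.cofinite_eq_atTop]
  have hfin : ((fun N : ℕ => (N : ℤ)) ⁻¹' (p.roots.toFinset : Set ℤ)).Finite :=
    (Finset.finite_toSet _).preimage Nat.cast_injective.injOn
  refine hfin.subset fun N hN => ?_
  have hN : evalHom N n v = 1 := by simpa using hN
  have hsum : ∑ i : Fin (n : ℕ), Multiplicative.toAdd v i * (N : ℤ) ^ (i : ℕ) = 0 := hN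
  simp only [Set.mem_preimage, Finset.mem_coe, Multiset.mem_toFinset]
  rw [Polynomial.mem_roots hp0, Polynomial.IsRoot.def, hp, Polynomial.eval_finsetSum]
  simpa using hsum

lemma exists_evalHom_lift_ne_one {g : FreeProdZ} (hg : g ≠ 1) :
    ∃ N : ℕ, CoprodI.lift (fun n => (CoprodI.of (i := n)).comp (evalHom N n)) g ≠
      (1 : CoprodI fun _ : ℕ+ => Multiplicative ℤ) := by
  have h : ∀ᶠ N in atTop, ∀ l ∈ {l | l ∈ syllables g}, evalHom N l.1 l.2 ≠ 1 :=
    (eventually_all_finite (List.finite_toSet _)).2 fun l hl =>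
      eventually_evalHom_ne_one ((isReducedList_syllables g).1 l hl)
  obtain ⟨N, hN⟩ := h.exists
  exact ⟨N, coprodI_map_ne_one _ hg hN⟩

lemma IsAmenable.commute_freeProdZ {H : Subgroup FreeProdZ} (hH : IsAmenable H) {x y : FreeProdZ}
    (hx : x ∈ H) (hy : y ∈ H) : Commute x y :=
  hH.commute_of_residuallyFree (F := CoprodI fun _ : ℕ+ => Multiplicative ℤ)
    (fun N : ℕ => CoprodI.lift fun n => (CoprodI.of (i := n)).comp (evalHom N n))
    (fun _ hg => exists_evalHom_lift_ne_one hg) hx hy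

end Amenable

/-! ### Abelian subgroups of free products are finitely generated -/

section Centralizers

lemma subgroup_fg_map {A B : Type*} [Group A] [Group B] {K : Subgroup A} (hK : K.FG) (φ : A →* B) :
    (K.map φ).FG := by
  classical
  obtain ⟨s, rfl⟩ := hK
  exact ⟨s.image φ, by rw [Finset.coe_image, MonoidHom.map_closure]⟩

variable {ι : Type*} {G : ι → Type*} [∀ i, Group (G i)] [DecidableEq ι] [∀ i, DecidableEq (G i)]

lemma length_syllables_inv (g : CoprodI G) : (syllables g⁻¹).length = (syllables g).length := by
  rw [syllables_inv, length_invList]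

lemma length_syllables_mul_le (g h : CoprodI G) :
    (syllables (g * h)).length ≤ (syllables g).length + (syllables h).length := by
  obtain ⟨P, C, D, hg, hh, H | ⟨i, s, t, C', D', rfl, rfl, H⟩⟩ := exists_syllables_inv_mul g⁻¹ h <;>
  · rw [inv_inv] at H
    rw [H, ← length_syllables_inv g, hg, hh]
    simp only [List.length_append, List.length_cons, length_invList]
    omega

/-- Adjacent syllables from one factor merge or cancel, so at least one syllable is lost. -/
lemma length_syllables_mul_lt {g h : CoprodI G} {a b : Σ i, G i}
    (ha : a ∈ (syllables g).getLast?) (hb : b ∈ (syllables h).head?) (hab : a.1 = b.1) :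
    (syllables (g * h)).length < (syllables g).length + (syllables h).length := by
  obtain ⟨P, C, D, hg, hh, H | ⟨i, s, t, C', D', rfl, rfl, H⟩⟩ := exists_syllables_inv_mul g⁻¹ h
  · rw [inv_inv] at H
    rw [H, ← length_syllables_inv g, hg, hh]
    cases P with
    | cons p P =>
      simp only [List.length_append, List.length_cons, length_invList]
      omega
    | nil =>
      exfalso
      have hred := isReducedList_syllables (g * h)
      rw [H, isReducedList_append] at hred
      have hC : invList C = syllables g := by
        rw [List.nil_append] at hg
        rw [← hg, ← syllables_inv, inv_inv]
      rw [List.nil_append] at hh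
      rw [hC, ← hh] at hred
      exact hred.2.2 a ha b hb hab
  · rw [inv_inv] at H
    rw [H, ← length_syllables_inv g, hg, hh]
    simp only [List.length_append, List.length_cons, length_invList]
    omega

lemma length_syllables_listProd_le (L : List (Σ i, G i)) :
    (syllables (listProd L)).length ≤ L.length := by
  induction L with
  | nil => simp [listProd_nil, syllables_one]
  | cons a L ih =>
    rw [listProd_cons, List.length_cons]
    have h1 : (syllables (CoprodI.of a.2 : CoprodI G)).length ≤ 1 := by
      by_cases ha : a.2 = 1
      · simp [ha, syllables_one]
      · simp [syllables_of ha]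
    have := length_syllables_mul_le (CoprodI.of a.2) (listProd L)
    omega

/-- When two words commute under concatenation, the shorter is a prefix of the longer and can be
stripped off. -/
lemma length_syllables_inv_mul_lt {x y : CoprodI G} (hx : x ≠ 1)
    (h : syllables x ++ syllables y = syllables y ++ syllables x)
    (hle : (syllables x).length ≤ (syllables y).length) :
    (syllables (x⁻¹ * y)).length < (syllables y).length := by
  obtain ⟨E, hE⟩ : syllables x <+: syllables y :=
    List.prefix_of_prefix_length_le ⟨_, h⟩ (List.prefix_append _ _) hle
  have hxy : x⁻¹ * y = listProd E := by
    rw [inv_mul_eq_iff_eq_mul, ← listProd_syllables y, ← hE, listProd_append, listProd_syllables]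
  have hpos : 0 < (syllables x).length :=
    List.length_pos_iff.2 fun h => hx (syllables_eq_nil.1 h)
  rw [hxy, ← hE, List.length_append]
  have := length_syllables_listProd_le E
  omega

lemma exists_head_getLast {g : CoprodI G} (hg : g ≠ 1) :
    ∃ a b, a ∈ (syllables g).head? ∧ b ∈ (syllables g).getLast? := by
  have h : syllables g ≠ [] := fun h => hg (syllables_eq_nil.1 h)
  exact ⟨(syllables g).head h, (syllables g).getLast h, List.head?_eq_some_head h,
    List.getLast?_eq_some_getLast h⟩

/-- An element commuting with a cyclically reduced element of syllable length at least two, and at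
least as long as it, can be shortened by it or its inverse. -/
lemma length_syllables_lt_of_commute {x y : CoprodI G} {a b : Σ i, G i}
    (ha : a ∈ (syllables x).head?) (hb : b ∈ (syllables x).getLast?) (hab : a.1 ≠ b.1)
    (hxy : Commute x y) (hle : (syllables x).length ≤ (syllables y).length) :
    (syllables (x⁻¹ * y)).length < (syllables y).length ∨
      (syllables (x * y)).length < (syllables y).length := by
  have hx : x ≠ 1 := by
    rintro rfl
    simp [syllables_one] at ha
  have hy : y ≠ 1 := by
    rintro rfl
    rw [syllables_one, List.length_nil, Nat.le_zero, List.length_eq_zero_iff] at hle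
    exact hx (syllables_eq_nil.1 hle)
  obtain ⟨c, d, hc, hd⟩ := exists_head_getLast hy
  have ha' : (⟨a.1, a.2⁻¹⟩ : Σ i, G i) ∈ (syllables x⁻¹).getLast? := by
    rw [syllables_inv, getLast?_invList]
    exact Option.mem_map_of_mem _ ha
  have hb' : (⟨b.1, b.2⁻¹⟩ : Σ i, G i) ∈ (syllables x⁻¹).head? := by
    rw [syllables_inv, head?_invList]
    exact Option.mem_map_of_mem _ hb
  have mul_of_ne : ∀ {u v : CoprodI G} {p q : Σ i, G i}, p ∈ (syllables u).getLast? →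
      q ∈ (syllables v).head? → p.1 ≠ q.1 → syllables (u * v) = syllables u ++ syllables v := by
    intro u v p q hp hq hpq
    refine syllables_mul fun p' hp' q' hq' => ?_
    rwa [Option.mem_unique hp' hp, Option.mem_unique hq' hq]
  -- In each case, either one of `x * y`, `y * x` merges while the other does not, contradicting
  -- equality of lengths, or one of `x`, `x⁻¹` multiplies `y` without merging on both sides. In the
  -- latter situation the words commute as lists and the prefix argument applies.
  by_cases h1 : b.1 = c.1
  · by_cases h2 : d.1 = b.1
    · exfalso
      have e1 := length_syllables_mul_lt hb hc h1
      rw [hxy.eq, mul_of_ne hd ha (by rw [h2]; exact hab.symm), List.length_append] at e1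
      omega
    · right
      have e1 := mul_of_ne ha' hc (by rw [← h1]; exact hab)
      have e2 := mul_of_ne hd hb' h2
      rw [hxy.inv_left.eq, e2] at e1
      have := length_syllables_inv_mul_lt (inv_ne_one.2 hx) e1.symm
        (by rwa [length_syllables_inv])
      rwa [inv_inv] at this
  · by_cases h2 : d.1 = a.1
    · by_cases h3 : a.1 = c.1
      · exfalso
        have e1 := length_syllables_mul_lt hd ha h2
        rw [← hxy.eq, mul_of_ne hb hc h1, List.length_append] at e1
        omega
      · right
        have e1 := mul_of_ne ha' hc h3
        have e2 := mul_of_ne hd hb' (by rw [h2]; exact hab)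
        rw [hxy.inv_left.eq, e2] at e1
        have := length_syllables_inv_mul_lt (inv_ne_one.2 hx) e1.symm
          (by rwa [length_syllables_inv])
        rwa [inv_inv] at this
    · left
      have e1 := mul_of_ne hb hc h1
      rw [hxy.eq, mul_of_ne hd ha h2] at e1
      exact length_syllables_inv_mul_lt hx e1.symm hle

/-- The centralizer of a nontrivial element of an abelian free factor is that factor. -/
lemma mem_range_of_commute {i : ι} (hcomm : ∀ s t : G i, Commute s t) {s : G i} (hs : s ≠ 1)
    {y : CoprodI G} (hy : Commute (CoprodI.of s) y) :
    y ∈ (CoprodI.of : G i →* CoprodI G).range := by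
  induction hk : (syllables y).length using Nat.strong_induction_on generalizing y with
  | _ k ih =>
    subst hk
    by_cases hy1 : y = 1
    · exact hy1 ▸ one_mem _
    obtain ⟨c, d, hc, hd⟩ := exists_head_getLast hy1
    have hls : syllables (CoprodI.of s : CoprodI G) = [⟨i, s⟩] := syllables_of hs
    by_cases hci : c.1 = i
    · obtain ⟨j, t⟩ := c
      obtain rfl : j = i := hci
      obtain ⟨L, hL⟩ : ∃ L, syllables y = ⟨j, t⟩ :: L := by
        cases h : syllables y with
        | nil => simp [h] at hc
        | cons a L => exact ⟨L, by simpa [h] using hc⟩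
      have hyL : y = CoprodI.of t * listProd L := by
        rw [← listProd_cons ⟨j, t⟩, ← hL, listProd_syllables]
      have hst : Commute (CoprodI.of s : CoprodI G) (CoprodI.of t) := (hcomm s t).map _
      have hLy : listProd L = (CoprodI.of t)⁻¹ * y := by rw [hyL, inv_mul_cancel_left]
      have hlt : (syllables (listProd L)).length < (syllables y).length := by
        rw [hL, List.length_cons]
        exact Nat.lt_succ_of_le (length_syllables_listProd_le L)
      rw [hyL]
      exact mul_mem ⟨t, rfl⟩ (ih _ hlt (by rw [hLy]; exact hst.inv_right.mul_right hy) rfl)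
    -- If `y` begins outside factor `i`, the word of `of s * y` begins with `s` and has one syllable
    -- more than `y`. But `y * of s` either has no extra syllable or still begins with the first
    -- syllable of `y`.
    · exfalso
      have e1 : syllables (CoprodI.of s * y) = ⟨i, s⟩ :: syllables y := by
        rw [syllables_mul, hls]
        · rfl
        · intro p hp q hq
          rw [hls] at hp
          simp only [List.getLast?_singleton, Option.mem_def, Option.some.injEq] at hp
          rw [← hp, Option.mem_unique hq hc]
          exact Ne.symm hci
      by_cases hdi : d.1 = i
      · have e2 := length_syllables_mul_lt (h := CoprodI.of s) (b := ⟨i, s⟩) hd (by simp [hls]) hdi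
        rw [← hy.eq, e1, hls] at e2
        simp at e2
      · have e2 : syllables (y * CoprodI.of s) = syllables y ++ [⟨i, s⟩] := by
          rw [syllables_mul, hls]
          intro p hp q hq
          rw [hls] at hq
          simp only [List.head?_cons, Option.mem_def, Option.some.injEq] at hq
          rw [← hq, Option.mem_unique hp hd]
          exact hdi
        rw [hy.eq, e2] at e1
        have e3 := congrArg List.head? e1
        rw [List.head?_append_of_ne_nil _ (fun h => hy1 (syllables_eq_nil.1 h)),
          Option.mem_def.1 hc] at e3
        simp only [List.head?_cons, Option.some.injEq] at e3
        exact hci (by rw [e3])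

/-- If `x` begins and ends in different factors, each `y ∈ H` is shortened by `x` or `x⁻¹` until it
is trivial, a Euclidean algorithm showing that `H` is generated by `x`. Otherwise minimality leaves
`x` a single syllable, and `H` lies in its centralizer, a factor. -/
lemma fg_of_forall_length_le (hcomm : ∀ i, ∀ s t : G i, Commute s t)
    (hfg : ∀ i, ∀ K : Subgroup (G i), K.FG) {H : Subgroup (CoprodI G)}
    (hH : ∀ x ∈ H, ∀ y ∈ H, Commute x y) {x : CoprodI G} (hxH : x ∈ H) (hx : x ≠ 1)
    (hmin : ∀ g, ∀ y ∈ H, y ≠ 1 → (syllables x).length ≤ (syllables (g * y * g⁻¹)).length) :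
    H.FG := by
  have hmin' : ∀ y ∈ H, y ≠ 1 → (syllables x).length ≤ (syllables y).length := fun y hy hy1 => by
    simpa using hmin 1 y hy hy1
  obtain ⟨a, b, ha, hb⟩ := exists_head_getLast hx
  by_cases hab : a.1 = b.1
  · obtain ⟨L, hL⟩ : ∃ L, syllables x = L ++ [b] := by
      rw [Option.mem_def, List.getLast?_eq_some_iff] at hb
      exact hb
    cases L with
    | nil =>
      obtain ⟨i, s⟩ := b
      have hxs : x = CoprodI.of s := by
        rw [← listProd_syllables x, hL]
        simp [listProd]
      have hle : H ≤ (CoprodI.of : G i →* CoprodI G).range := fun y hy => by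
        refine mem_range_of_commute (hcomm i) (s := s) ?_ (hxs ▸ hH x hxH y hy)
        rintro rfl
        exact hx (by rw [hxs, map_one])
      rw [← Subgroup.map_comap_eq_self hle]
      exact subgroup_fg_map (hfg i _) _
    -- Conjugating by the last syllable moves it to the front, where it merges with the first one.
    -- The conjugate is shorter than `x`, against minimality over conjugates.
    | cons p L =>
      exfalso
      have hpa : p = a := by
        rw [hL] at ha
        simpa using ha
      have hred := isReducedList_syllables x
      rw [hL, isReducedList_append] at hred
      have hsyl : syllables (listProd (p :: L)) = p :: L := syllables_listProd hred.1
      have hb1 : b.2 ≠ 1 := hred.2.1.1 b (by simp)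
      have h1 : CoprodI.of b.2 * x * (CoprodI.of b.2)⁻¹ = CoprodI.of b.2 * listProd (p :: L) := by
        rw [← listProd_syllables x, hL, listProd_append, listProd_cons b, listProd_nil]
        group
      have h2 := hmin (CoprodI.of b.2) x hxH hx
      have h3 := length_syllables_mul_lt (g := CoprodI.of b.2) (h := listProd (p :: L))
        (a := b) (b := p) (by rw [syllables_of hb1]; simp) (by rw [hsyl]; simp)
        (by rw [hpa, hab])
      rw [h1, hL] at h2
      rw [syllables_of hb1, hsyl] at h3
      simp only [List.length_append, List.length_cons, List.length_nil] at h2 h3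
      omega
  · have hle : ∀ y ∈ H, y ∈ Subgroup.zpowers x := by
      intro y hy
      induction hk : (syllables y).length using Nat.strong_induction_on generalizing y with
      | _ k ih =>
        subst hk
        by_cases hy1 : y = 1
        · exact hy1 ▸ one_mem _
        rcases length_syllables_lt_of_commute ha hb hab (hH x hxH y hy) (hmin' y hy hy1) with h | h
        · have := ih _ h _ (mul_mem (inv_mem hxH) hy) rfl
          have h2 := mul_mem (Subgroup.mem_zpowers x) this
          rwa [mul_inv_cancel_left] at h2
        · have := ih _ h _ (mul_mem hxH hy) rfl
          have h2 := mul_mem (inv_mem (Subgroup.mem_zpowers x)) this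
          rwa [inv_mul_cancel_left] at h2
    have : H = Subgroup.zpowers x :=
      le_antisymm hle ((Subgroup.zpowers_le).2 hxH)
    rw [this, Subgroup.zpowers_eq_closure]
    exact ⟨{x}, by simp⟩

/-- If all subgroups of the abelian free factors are finitely generated, then so are all abelian
subgroups of the free product. -/
theorem fg_of_commute (hcomm : ∀ i, ∀ s t : G i, Commute s t)
    (hfg : ∀ i, ∀ K : Subgroup (G i), K.FG) {H : Subgroup (CoprodI G)}
    (hH : ∀ x ∈ H, ∀ y ∈ H, Commute x y) : H.FG := by
  classical
  by_cases hbot : H = ⊥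
  · rw [hbot]
    exact ⟨∅, by simp⟩
  obtain ⟨⟨z, hzH⟩, hz'⟩ := Subgroup.ne_bot_iff_exists_ne_one.1 hbot
  have hz : z ≠ 1 := fun h => hz' (Subtype.ext h)
  -- The length is minimized over nontrivial elements and conjugators simultaneously, so that the
  -- minimality survives further conjugation.
  have hex : ∃ n : ℕ, ∃ g, ∃ y ∈ H, y ≠ 1 ∧ (syllables (g * y * g⁻¹)).length = n :=
    ⟨_, 1, z, hzH, hz, rfl⟩
  obtain ⟨g, x, hxH, hx, hn⟩ := Nat.find_spec hex
  have hmin : ∀ g' y, y ∈ H → y ≠ 1 →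
      (syllables (g * x * g⁻¹)).length ≤ (syllables (g' * y * g'⁻¹)).length := fun g' y hy hy1 => by
    rw [hn]
    exact Nat.find_min' hex ⟨g', y, hy, hy1, rfl⟩
  have key : (H.map (MulAut.conj g).toMonoidHom).FG := by
    refine fg_of_forall_length_le hcomm hfg (x := g * x * g⁻¹) ?_ ⟨x, hxH, rfl⟩
      (by simpa using hx) ?_
    · rintro _ ⟨u, hu, rfl⟩ _ ⟨v, hv, rfl⟩
      exact (hH u hu v hv).map _
    · rintro g' _ ⟨u, hu, rfl⟩ hu1
      have := hmin (g' * g) u hu (by rintro rfl; exact hu1 (map_one _))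
      simpa [mul_assoc] using this
  have h2 := subgroup_fg_map key (MulAut.conj g⁻¹).toMonoidHom
  rw [Subgroup.map_map] at h2
  convert h2
  rw [show (MulAut.conj g⁻¹).toMonoidHom.comp (MulAut.conj g).toMonoidHom =
    MonoidHom.id (CoprodI G) by ext y; simp, Subgroup.map_id]

end Centralizers

/-! ### Polynomial growth -/

section PolynomialGrowth

lemma subgroup_zpow_fg (n : ℕ+) (K : Subgroup (ZPow n)) : K.FG := by
  set K' : AddSubgroup (Fin (n : ℕ) → ℤ) := AddSubgroup.toSubgroup.symm K with hK
  have h : (AddSubgroup.toIntSubmodule K').FG := IsNoetherian.noetherian _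
  rw [Submodule.fg_iff_addSubgroup_fg, AddSubgroup.toIntSubmodule_toAddSubgroup,
    AddSubgroup.fg_iff_mul_fg, hK, OrderIso.apply_symm_apply] at h
  exact h

/-- Commutativity lets the letters of a word be collected generator by generator. Each letter
changes one exponent by `±1`, so balls are covered by boxes of exponents. -/
lemma exists_zpow_prod_eq {A : Type*} [CommGroup A] (S : Finset A) (w : List A)
    (hw : ∀ s ∈ w, s ∈ S ∨ s⁻¹ ∈ S) :
    ∃ e : S → ℤ, (∀ s, |e s| ≤ w.length) ∧ ∏ s : S, (s : A) ^ e s = w.prod := by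
  classical
  induction w with
  | nil => exact ⟨0, by simp, by simp⟩
  | cons a w ih =>
    obtain ⟨e, he, hprod⟩ := ih fun s hs => hw s (List.mem_cons_of_mem _ hs)
    have key : ∀ (t : S) (k : ℤ), |k| ≤ 1 → (t : A) ^ k = a →
        ∃ e : S → ℤ, (∀ s, |e s| ≤ (a :: w).length) ∧ ∏ s : S, (s : A) ^ e s = (a :: w).prod := by
      intro t k hk hta
      refine ⟨Pi.single t k + e, fun s => ?_, ?_⟩
      · rw [List.length_cons, Pi.add_apply]
        refine (abs_add_le _ _).trans ?_
        have h1 : |(Pi.single t k : S → ℤ) s| ≤ 1 := by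
          by_cases hst : s = t
          · subst hst
            simpa using hk
          · simp [hst]
        have := he s
        push_cast
        linarith
      · simp only [Pi.add_apply, zpow_add, Finset.prod_mul_distrib, hprod, List.prod_cons]
        congr 1
        rw [Finset.prod_eq_single t]
        · simpa using hta
        · intro s _ hst
          simp [hst]
        · simp
    rcases hw a List.mem_cons_self with h | h
    · exact key ⟨a, h⟩ 1 (by simp) (by simp)
    · exact key ⟨a⁻¹, h⟩ (-1) (by simp) (by simp)

lemma hasPolynomialGrowth_of_commGroup {A : Type*} [CommGroup A] (hA : Group.FG A) :
    HasPolynomialGrowth A := by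
  classical
  refine ⟨hA, fun S hS _ => ?_⟩
  obtain ⟨S, rfl⟩ := hS.exists_finset_coe
  refine ⟨2 ^ S.card, S.card, fun n => ?_⟩
  set B : Finset A := (Fintype.piFinset fun _ : S => Finset.Icc (-(n : ℤ)) n).image
    fun e => ∏ s : S, (s : A) ^ e s with hB
  have hsub : wordBall (S : Set A) n ⊆ B := by
    rintro g ⟨w, hlen, hw, rfl⟩
    obtain ⟨e, he, hprod⟩ := exists_zpow_prod_eq S w (by simpa using hw)
    refine Finset.mem_coe.2 (Finset.mem_image.2 ⟨e, Fintype.mem_piFinset.2 fun s => ?_, hprod⟩)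
    rw [Finset.mem_Icc, ← abs_le]
    exact (he s).trans (by exact_mod_cast hlen)
  calc (wordBall (S : Set A) n).ncard ≤ (B : Set A).ncard :=
        Set.ncard_le_ncard hsub (Finset.finite_toSet _)
    _ = B.card := Set.ncard_coe_finset B
    _ ≤ (2 * n + 1) ^ S.card := by
        refine Finset.card_image_le.trans_eq ?_
        rw [Fintype.card_piFinset]
        simp only [Int.card_Icc, Finset.prod_const, Finset.card_univ, Fintype.card_coe]
        congr 1
        omega
    _ ≤ (2 * (n + 1)) ^ S.card := Nat.pow_le_pow_left (by omega) _
    _ = 2 ^ S.card * (n + 1) ^ S.card := mul_pow _ _ _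

theorem hasPolynomialGrowth_of_isAmenable {H : Subgroup FreeProdZ} (hH : IsAmenable H) :
    HasPolynomialGrowth H := by
  have hcomm : ∀ x ∈ H, ∀ y ∈ H, Commute x y := fun _ hx _ hy => hH.commute_freeProdZ hx hy
  have hfg : H.FG := fg_of_commute (fun _ => Commute.all) subgroup_zpow_fg hcomm
  let _ : CommGroup H :=
    { (inferInstance : Group H) with
      mul_comm := fun x y => Subtype.ext (hcomm x x.2 y y.2) }
  exact hasPolynomialGrowth_of_commGroup ((Group.fg_iff_subgroup_fg H).2 hfg)

end PolynomialGrowth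

end GroupDecay

open GroupDecay
theorem mainTheorem5 (f : ℕ → ℕ) (hf : StrictMonoOn f (Set.Ici 1)) (hf1 : f 1 = 1)
    (hinv : (fun N : ℕ => (floorInverse f N : ℝ)) =o[atTop]
      fun N : ℕ => (N : ℝ) / Real.log (N : ℝ)) :
    HasSDWithRespectTo (freeProdLength f) ∧
    ¬ HasRD FreeProdZ ∧
    ∀ H : Subgroup FreeProdZ, IsAmenable H → HasPolynomialGrowth H :=
  ⟨hasSD_freeProdLength hf hf1 hinv, not_hasRD_freeProdZ,
    fun _ hH => hasPolynomialGrowth_of_isAmenable hH⟩
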